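/- Let $\mathbb K$ be an algebraically closed field of characteristic $p>2$ and let $\varepsilon\in\{1,-1\}$. A quadratic space of type $\varepsilon$ is a finite-dimensional $\mathbb K$-vector space with a nondegenerate bilinear form $(\cdot,\cdot)$ satisfying $(x,y)=\varepsilon(y,x)$. Let $V$ be a quadratic space of type $\varepsilon$ and $U$ a quadratic space of type $-\varepsilon$, with $n=\dim V\ge m=\dim U$. Let $G(U)\subset\mathrm{End}(U)$ be the group of isometries of $U$ (an orthogonal or symplectic group, considered as an algebraic group), and let $\mathfrak g(U)\subset \mathrm{End}(U)$ and $\mathfrak g(V)\subset \mathrm{End}(V)$ be the Lie algebras of endomorphisms that are skew-adjoint for the given forms. For a linear map $X:V\to U$ let $X^*:U\to V$ be its adjoint, the unique linear map with $(Xv,u)=(v,X^*u)$ for all $v\in V$, $u\in U$, and put $\pi(X)=XX^*\in\mathfrak g(U)$ and $\rho(X)=X^*X\in\mathfrak g(V)$. Let $L'$ be the open subvariety of $\mathrm{Hom}(V,U)$ consisting of the surjective maps. Then: (1) The restriction $\pi|_{L'}:L'\to\mathfrak g(U)$ is a smooth morphism of varieties, and $\pi(L')=\{D\in\mathfrak g(U)\mid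 \operatorname{rank} D\ge 2m-n\}$. (2) $\rho(L')=\{D\in\mathfrak g(V)\mid\operatorname{rank}D=m\}$. With $\rho(L')$ regarded as a locally closed subvariety of $\mathfrak g(V)$ (with its reduced structure), $\rho|_{L'}:L'\to\rho(L')$ is a smooth morphism of varieties, and for every $D\in\rho(L')$ the scheme-theoretic fiber of $\rho|_{L'}$ over $D$ is isomorphic to $G(U)$ over $\mathbb K$. -/

import Mathlib

open AlgebraicGeometry CategoryTheory

universe u

set_option linter.unusedSectionVars false

namespace QuadraticPair

noncomputable section

/-! ### Varieties given by locally closed subsets of a finite-dimensional vector space -/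

section Variety

variable (K : Type u) [Field K] {W W' : Type u} [AddCommGroup W] [Module K W]
  [AddCommGroup W'] [Module K W']

/-- The algebra of polynomial functions on the `K`-vector space `W`: the functions that are
polynomial expressions in linear forms. -/
def polyFun (W : Type u) [AddCommGroup W] [Module K W] : Subalgebra K (W → K) :=
  Algebra.adjoin K (Set.range fun φ : Module.Dual K W => (φ : W → K))

/-- Restriction of functions from `W` to a subset. -/
def restrict (S : Set W) : (W → K) →ₐ[K] (S → K) where
  toFun f s := f s
  map_one' := rfl
  map_mul' _ _ := rfl
  map_zero' := rfl
  map_add' _ _ := rfl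
  commutes' _ := rfl

/-- The algebra of all restrictions to `S` of polynomial functions on `W`. It is reduced, and
it is the coordinate ring of the Zariski closure of `S` with its reduced structure. -/
def coordRing (S : Set W) : Subalgebra K (S → K) := (polyFun K W).map (restrict K S)

/-- `S` is locally closed in the Zariski topology of `W`: it is the intersection of a closed set
(the common zeros of the polynomials in `I`) and of an open set (the points where
not all polynomials in `J` vanish). -/
def IsZariskiLocallyClosed (S : Set W) : Prop :=
  ∃ I J : Set (W → K), I ⊆ polyFun K W ∧ J ⊆ polyFun K W ∧
    S = {w | (∀ f ∈ I, f w = 0) ∧ ∃ g ∈ J, g w ≠ 0}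

/-- Evaluation at a point of `S`. -/
def evalAt (S : Set W) (s : S) : coordRing K S →ₐ[K] K where
  toFun f := f.1 s
  map_one' := rfl
  map_mul' _ _ := rfl
  map_zero' := rfl
  map_add' _ _ := rfl
  commutes' _ := rfl

/-- The closed point of `Spec K[S]` defined by the point `s` of `S`. -/
def specPt (S : Set W) (s : S) : PrimeSpectrum (coordRing K S) :=
  ⟨RingHom.ker (evalAt K S s), RingHom.ker_isPrime _⟩

theorem linear_mem_polyFun (φ : Module.Dual K W) : (φ : W → K) ∈ polyFun K W :=
  Algebra.subset_adjoin ⟨φ, rfl⟩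

theorem polyFun_comp (f : W → W')
    (h : ∀ φ : Module.Dual K W', (fun w => φ (f w)) ∈ polyFun K W)
    {g : W' → K} (hg : g ∈ polyFun K W') : (fun w => g (f w)) ∈ polyFun K W := by
  induction hg using Algebra.adjoin_induction with
  | mem x hx => obtain ⟨φ, rfl⟩ := hx; exact h φ
  | algebraMap r => exact (polyFun K W).algebraMap_mem r
  | add x y _ _ hx hy => exact (polyFun K W).add_mem hx hy
  | mul x y _ _ hx hy => exact (polyFun K W).mul_mem hx hy

theorem polyFun_comp_linear (ℓ : W →ₗ[K] W') {g : W' → K} (hg : g ∈ polyFun K W') :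
    (fun w => g (ℓ w)) ∈ polyFun K W :=
  polyFun_comp K ℓ (fun φ => linear_mem_polyFun K (φ ∘ₗ ℓ)) hg

theorem bilin_mem_polyFun [FiniteDimensional K W] (b : W →ₗ[K] W →ₗ[K] K) :
    (fun w => b w w) ∈ polyFun K W := by
  let e := Module.finBasis K W
  have h : (fun w => b w w) = ∑ i, (e.coord i : W → K) * (b (e i) : W → K) := by
    funext w
    have hw : b w = ∑ i, e.repr w i • b (e i) := by
      conv_lhs => rw [← e.sum_repr w]
      rw [map_sum]
      simp only [map_smul]
    simp [hw, Finset.sum_apply]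
  rw [h]
  exact Subalgebra.sum_mem _ fun i _ =>
    Subalgebra.mul_mem _ (linear_mem_polyFun K _) (linear_mem_polyFun K _)

theorem det_mem_polyFun [FiniteDimensional K W] :
    (fun D : Module.End K W => LinearMap.det D) ∈ polyFun K (Module.End K W) := by
  let e := Module.finBasis K W
  have h : (fun D : Module.End K W => LinearMap.det D) =
      ∑ σ : Equiv.Perm (Fin (Module.finrank K W)), (Equiv.Perm.sign σ : ℤ) •
        ∏ i, (fun D : Module.End K W => e.coord (σ i) (D (e i))) := by
    funext D
    rw [← LinearMap.det_toMatrix e, Matrix.det_apply]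
    simp [Finset.sum_apply, Finset.prod_apply, LinearMap.toMatrix_apply, Units.smul_def]
  rw [h]
  refine Subalgebra.sum_mem _ fun σ _ => Subalgebra.zsmul_mem _ (Subalgebra.prod_mem _ fun i _ => ?_) _
  exact linear_mem_polyFun K
    (e.coord (σ i) ∘ₗ (LinearMap.applyₗ (e i) : Module.End K W →ₗ[K] W))

theorem coordRing_comp {S : Set W} {T : Set W'} (f : W → W') (hf : Set.MapsTo f S T)
    (hpoly : ∀ φ : Module.Dual K W', (fun w => φ (f w)) ∈ polyFun K W) (g : T → K)
    (hg : g ∈ coordRing K T) : (fun s => g (hf.restrict f S T s)) ∈ coordRing K S := by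
  obtain ⟨g, hg, rfl⟩ := hg
  exact ⟨_, polyFun_comp K f hpoly hg, rfl⟩

/-- The comorphism `K[T] → K[S]`, `g ↦ g ∘ f`, of a polynomial map `f` that sends `S` to `T`. -/
def comorphism {S : Set W} {T : Set W'} (f : W → W') (hf : Set.MapsTo f S T)
    (hpoly : ∀ φ : Module.Dual K W', (fun w => φ (f w)) ∈ polyFun K W) :
    coordRing K T →ₐ[K] coordRing K S where
  toFun g := ⟨fun s => g.1 (hf.restrict f S T s), coordRing_comp K f hf hpoly g.1 g.2⟩
  map_one' := rfl
  map_mul' _ _ := rfl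
  map_zero' := rfl
  map_add' _ _ := rfl
  commutes' _ := rfl

variable [IsAlgClosed K] [FiniteDimensional K W]

instance finiteType_polyFun : Algebra.FiniteType K (polyFun K W) := by
  classical
  let e := Module.finBasis K W
  refine (Subalgebra.fg_iff_finiteType _).1 ?_
  refine ⟨Finset.univ.image fun i => (e.coord i : W → K), le_antisymm ?_ ?_⟩
  · refine Algebra.adjoin_mono ?_
    simp only [Finset.coe_image, Finset.coe_univ, Set.image_univ]
    rintro _ ⟨i, rfl⟩
    exact ⟨_, rfl⟩
  · refine Algebra.adjoin_le ?_
    rintro _ ⟨φ, rfl⟩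
    have h : (φ : W → K) = ∑ i, φ (e i) • (e.coord i : W → K) := by
      funext w
      conv_lhs => rw [← e.sum_repr w, map_sum]
      simp [Finset.sum_apply, mul_comm]
    refine Eq.subst (motive := fun f => f ∈ Algebra.adjoin K _) h.symm ?_
    refine Subalgebra.sum_mem _ fun i _ => Subalgebra.smul_mem _ (Algebra.subset_adjoin ?_) _
    exact Finset.mem_coe.2 (Finset.mem_image_of_mem _ (Finset.mem_univ i))

instance finiteType_coordRing (S : Set W) : Algebra.FiniteType K (coordRing K S) :=
  (Subalgebra.fg_iff_finiteType _).1
    (((Subalgebra.fg_iff_finiteType _).2 (finiteType_polyFun K)).map _)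

/-- The restriction of a polynomial function, as an element of `K[S]`. -/
def res (S : Set W) {f : W → K} (hf : f ∈ polyFun K W) : coordRing K S :=
  ⟨restrict K S f, f, hf, rfl⟩

theorem exists_point_of_algHom (S : Set W) (χ : coordRing K S →ₐ[K] K) :
    ∃ w : W, ∀ (f : W → K) (hf : f ∈ polyFun K W), χ (res K S hf) = f w := by
  let ψ : Module.Dual K (Module.Dual K W) :=
    { toFun := fun φ => χ (res K S (linear_mem_polyFun K φ))
      map_add' := fun a b => by rw [← map_add]; rfl
      map_smul' := fun c a => by rw [RingHom.id_apply, ← map_smul]; rfl }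
  refine ⟨(Module.evalEquiv K W).symm ψ, fun f hf => ?_⟩
  induction hf using Algebra.adjoin_induction with
  | mem x hx =>
    obtain ⟨φ, rfl⟩ := hx
    exact (Module.apply_evalEquiv_symm_apply K W φ ψ).symm
  | algebraMap r => exact χ.commutes r
  | add x y hx hy ihx ihy =>
    rw [Pi.add_apply, ← ihx, ← ihy, ← map_add]; rfl
  | mul x y hx hy ihx ihy =>
    rw [Pi.mul_apply, ← ihx, ← ihy, ← map_mul]; rfl

theorem exists_algHom_of_isMaximal (S : Set W) (m : Ideal (coordRing K S)) [hm : m.IsMaximal] :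
    ∃ χ : coordRing K S →ₐ[K] K, RingHom.ker χ = m := by
  let _ : Field (coordRing K S ⧸ m) := Ideal.Quotient.field m
  have : Module.Finite K (coordRing K S ⧸ m) := finite_of_finite_type_of_isJacobsonRing K _
  have : Algebra.IsIntegral K (coordRing K S ⧸ m) := Algebra.IsIntegral.of_finite K _
  have hb : Function.Bijective (Algebra.ofId K (coordRing K S ⧸ m)) :=
    IsAlgClosed.algebraMap_bijective_of_isIntegral
  let e := AlgEquiv.ofBijective _ hb
  refine ⟨e.symm.toAlgHom.comp (Ideal.Quotient.mkₐ K m), ?_⟩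
  ext x
  simp [RingHom.mem_ker, Ideal.Quotient.eq_zero_iff_mem]

/-- For a locally closed `S`, the open subset of `Spec K[S]` that consists of all
generalizations of the points of `S`. Its closed points are the points of `S`. -/
def varietyOpen {S : Set W} (hS : IsZariskiLocallyClosed K S) :
    (Spec (.of (coordRing K S))).Opens where
  carrier := {p : PrimeSpectrum (coordRing K S) | ∃ s : S, p.asIdeal ≤ (specPt K S s).asIdeal}
  is_open' := by
    change IsOpen {p : PrimeSpectrum (coordRing K S) |
      ∃ s : S, p.asIdeal ≤ (specPt K S s).asIdeal}
    rw [isOpen_iff_forall_mem_open]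
    rintro p ⟨s, hs⟩
    obtain ⟨I, J, hI, hJ, hSeq⟩ := id hS
    have hs2 : (s : W) ∈ {w | (∀ f ∈ I, f w = 0) ∧ ∃ g ∈ J, g w ≠ 0} := hSeq.subset s.2
    obtain ⟨-, g, hgJ, hgs⟩ := hs2
    refine ⟨PrimeSpectrum.basicOpen (res K S (hJ hgJ)), ?_, PrimeSpectrum.isOpen_basicOpen,
      fun h => hgs (hs h)⟩
    intro q hq
    have : IsJacobsonRing (coordRing K S) := isJacobsonRing_of_finiteType (A := K)
    have hq' : res K S (hJ hgJ) ∉ q.asIdeal.jacobson := by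
      rw [IsJacobsonRing.out inferInstance q.isPrime.isRadical]; exact hq
    rw [Ideal.jacobson, Ideal.mem_sInf] at hq'
    push Not at hq'
    obtain ⟨m, ⟨hqm, hm⟩, hgm⟩ := hq'
    obtain ⟨χ, hχ⟩ := exists_algHom_of_isMaximal K S m
    obtain ⟨w, hw⟩ := exists_point_of_algHom K S χ
    have hwS : w ∈ S := by
      have : w ∈ {w | (∀ f ∈ I, f w = 0) ∧ ∃ g ∈ J, g w ≠ 0} := by
        refine ⟨fun f hf => ?_, g, hgJ, fun h => hgm ?_⟩
        · rw [← hw f (hI hf)]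
          have h0 : res K S (hI hf) = 0 := by
            apply Subtype.ext
            funext t
            have ht : (t : W) ∈ {w | (∀ f ∈ I, f w = 0) ∧ ∃ g ∈ J, g w ≠ 0} :=
              hSeq.subset t.2
            exact ht.1 f hf
          rw [h0, map_zero]
        · rw [← hχ, RingHom.mem_ker, hw, h]
      rw [hSeq]; exact this
    refine ⟨⟨w, hwS⟩, fun a ha => ?_⟩
    have ham : a ∈ RingHom.ker χ := hχ ▸ hqm ha
    obtain ⟨_, f, hf, rfl⟩ := a
    change f w = 0
    rw [← hw f hf]
    exact ham

/-- The (reduced) variety over `K` whose `K`-points are the points of the locally closed set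
`S`. -/
def variety {S : Set W} (hS : IsZariskiLocallyClosed K S) : Scheme.{u} :=
  (varietyOpen K hS).toScheme

/-- The structure morphism of the variety to `Spec K`. -/
def variety.toSpec {S : Set W} (hS : IsZariskiLocallyClosed K S) :
    variety K hS ⟶ Spec (.of K) :=
  (varietyOpen K hS).ι ≫ Spec.map (CommRingCat.ofHom (algebraMap K (coordRing K S)))

/-- A point of `S` as a closed point of the variety. -/
def variety.pt {S : Set W} (hS : IsZariskiLocallyClosed K S) (s : S) : variety K hS :=
  (⟨specPt K S s, s, le_rfl⟩ : varietyOpen K hS)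

variable [FiniteDimensional K W']

/-- The morphism of varieties given by a polynomial map `f` that sends `S` to `T`. -/
def variety.map {S : Set W} {T : Set W'} (hS : IsZariskiLocallyClosed K S)
    (hT : IsZariskiLocallyClosed K T) (f : W → W') (hf : Set.MapsTo f S T)
    (hpoly : ∀ φ : Module.Dual K W', (fun w => φ (f w)) ∈ polyFun K W) :
    variety K hS ⟶ variety K hT :=
  (Spec.map (CommRingCat.ofHom (comorphism K f hf hpoly).toRingHom)).resLE
    (varietyOpen K hT) (varietyOpen K hS) (by
      rintro p ⟨s, hs⟩
      exact ⟨hf.restrict f S T s, fun g hg => hs hg⟩)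

end Variety

/-! ### Quadratic spaces, adjoints and the maps `π` and `ρ` -/

section Forms

variable {K : Type u} [Field K] {V U : Type u} [AddCommGroup V] [Module K V]
  [FiniteDimensional K V] [AddCommGroup U] [Module K U] [FiniteDimensional K U]

/-- `(V, B)` is a quadratic space of type `ε`: the bilinear form `B` is nondegenerate and
`B x y = ε B y x` (used for `ε = 1`, orthogonal, and `ε = -1`, symplectic). -/
structure IsQuadraticSpace (B : LinearMap.BilinForm K V) (ε : K) : Prop where
  nondegenerate : B.Nondegenerate
  symm : ∀ x y, B x y = ε * B y x

/-- The group `G(U)` of isometries of the form (`O(U)` or `Sp(U)`), as a subset of `End U`; an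
isometry of a nondegenerate form on a finite-dimensional space is automatically invertible. -/
def isometries (B : LinearMap.BilinForm K U) : Set (Module.End K U) := {g | B.IsOrthogonal g}

/-- The Lie algebra `𝔤(V)` (`𝔰𝔬(V)` or `𝔰𝔭(V)`): the `D` with `(D x, y) = -(x, D y)`. -/
def lieAlg (B : LinearMap.BilinForm K V) : Set (Module.End K V) := {D | B.IsSkewAdjoint D}

/-- The set `L'` of surjective linear maps. -/
def surj (K V U : Type u) [Field K] [AddCommGroup V] [Module K V] [AddCommGroup U]
    [Module K U] : Set (V →ₗ[K] U) := {X | Function.Surjective X}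

/-- The elements of rank `r` in the Lie algebra. -/
def rankLocus (B : LinearMap.BilinForm K V) (r : ℕ) : Set (Module.End K V) :=
  {D | D ∈ lieAlg B ∧ Module.finrank K (LinearMap.range D) = r}

/-- The adjoint `X* : U → V` of `X : V → U`, as a linear function of `X`. -/
def adj {BV : LinearMap.BilinForm K V} (hV : BV.Nondegenerate) (BU : LinearMap.BilinForm K U) :
    (V →ₗ[K] U) →ₗ[K] (U →ₗ[K] V) where
  toFun X := (BV.flip.toDual hV.flip).symm.toLinearMap ∘ₗ X.dualMap ∘ₗ BU.flip
  map_add' X Y := by ext u; simp [LinearMap.dualMap, Module.Dual.transpose]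
  map_smul' c X := by ext u; simp [LinearMap.dualMap, Module.Dual.transpose]

/-- The defining property `(X v, u) = (v, X* u)`. -/
theorem adj_spec {BV : LinearMap.BilinForm K V} (hV : BV.Nondegenerate)
    (BU : LinearMap.BilinForm K U) (X : V →ₗ[K] U) (v : V) (u : U) :
    BU (X v) u = BV v (adj hV BU X u) := by
  have h := LinearMap.BilinForm.apply_toDual_symm_apply (hB := hV.flip)
    (X.dualMap (BU.flip u)) v
  exact h.symm

/-- `X*` is the unique linear map with the defining property. -/
theorem adj_unique {BV : LinearMap.BilinForm K V} (hV : BV.Nondegenerate)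
    (BU : LinearMap.BilinForm K U) (X : V →ₗ[K] U) (Y : U →ₗ[K] V)
    (h : ∀ v u, BU (X v) u = BV v (Y u)) : Y = adj hV BU X := by
  ext u
  refine (sub_eq_zero.1 (hV.2 _ fun v => ?_))
  rw [map_sub, ← h, ← adj_spec, sub_self]

/-- `π(X) = X X*`. -/
def piMap {BV : LinearMap.BilinForm K V} (hV : BV.Nondegenerate) (BU : LinearMap.BilinForm K U)
    (X : V →ₗ[K] U) : Module.End K U := X ∘ₗ adj hV BU X

/-- `ρ(X) = X* X`. -/
def rhoMap {BV : LinearMap.BilinForm K V} (hV : BV.Nondegenerate) (BU : LinearMap.BilinForm K U)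
    (X : V →ₗ[K] U) : Module.End K V := adj hV BU X ∘ₗ X

variable {BV : LinearMap.BilinForm K V} {BU : LinearMap.BilinForm K U} {ε : K}

theorem adj_spec' (hε : ε = 1 ∨ ε = -1) (hV : IsQuadraticSpace BV ε)
    (hU : IsQuadraticSpace BU (-ε)) (X : V →ₗ[K] U) (u : U) (v : V) :
    BV (adj hV.nondegenerate BU X u) v = -BU u (X v) := by
  rw [hV.symm, ← adj_spec, hU.symm]
  rcases hε with rfl | rfl <;> simp

theorem piMap_mem (hε : ε = 1 ∨ ε = -1) (hV : IsQuadraticSpace BV ε)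
    (hU : IsQuadraticSpace BU (-ε)) (X : V →ₗ[K] U) :
    piMap hV.nondegenerate BU X ∈ lieAlg BU := by
  intro x y
  have h := adj_spec' hε hV hU X x (adj hV.nondegenerate BU X y)
  rw [← adj_spec] at h
  simpa [piMap] using h

theorem rhoMap_mem (hε : ε = 1 ∨ ε = -1) (hV : IsQuadraticSpace BV ε)
    (hU : IsQuadraticSpace BU (-ε)) (X : V →ₗ[K] U) :
    rhoMap hV.nondegenerate BU X ∈ lieAlg BV := by
  intro x y
  have h := adj_spec' hε hV hU X (X x) y
  rw [adj_spec hV.nondegenerate] at h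
  simpa [rhoMap] using h

theorem adj_injective (hV : BV.Nondegenerate) (hU : BU.Nondegenerate) {X : V →ₗ[K] U}
    (hX : Function.Surjective X) : Function.Injective (adj hV BU X) := by
  rw [injective_iff_map_eq_zero]
  intro u hu
  refine hU.2 u fun x => ?_
  obtain ⟨v, rfl⟩ := hX x
  rw [adj_spec hV, hu, map_zero]

theorem piMap_mapsTo (hε : ε = 1 ∨ ε = -1) (hV : IsQuadraticSpace BV ε)
    (hU : IsQuadraticSpace BU (-ε)) :
    Set.MapsTo (piMap hV.nondegenerate BU) (surj K V U) (lieAlg BU) :=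
  fun X _ => piMap_mem hε hV hU X

theorem rhoMap_mapsTo (hε : ε = 1 ∨ ε = -1) (hV : IsQuadraticSpace BV ε)
    (hU : IsQuadraticSpace BU (-ε)) :
    Set.MapsTo (rhoMap hV.nondegenerate BU) (surj K V U)
      (rankLocus BV (Module.finrank K U)) := by
  intro X hX
  refine ⟨rhoMap_mem hε hV hU X, ?_⟩
  rw [rhoMap, LinearMap.range_comp, LinearMap.range_eq_top.2 hX, Submodule.map_top]
  exact LinearMap.finrank_range_of_inj (adj_injective hV.nondegenerate hU.nondegenerate hX)

theorem piMap_poly (hV : BV.Nondegenerate) (φ : Module.Dual K (Module.End K U)) :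
    (fun X => φ (piMap hV BU X)) ∈ polyFun K (V →ₗ[K] U) :=
  bilin_mem_polyFun K (LinearMap.mk₂ K (fun X Y : V →ₗ[K] U => φ (X ∘ₗ adj hV BU Y))
    (by intros; simp [LinearMap.add_comp]) (by intros; simp [LinearMap.smul_comp])
    (by intros; simp [LinearMap.comp_add]) (by intros; simp [LinearMap.comp_smul]))

theorem rhoMap_poly (hV : BV.Nondegenerate) (φ : Module.Dual K (Module.End K V)) :
    (fun X => φ (rhoMap hV BU X)) ∈ polyFun K (V →ₗ[K] U) :=
  bilin_mem_polyFun K (LinearMap.mk₂ K (fun X Y : V →ₗ[K] U => φ (adj hV BU X ∘ₗ Y))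
    (by intros; simp [LinearMap.add_comp]) (by intros; simp [LinearMap.smul_comp])
    (by intros; simp [LinearMap.comp_add]) (by intros; simp [LinearMap.comp_smul]))

/-! The sets `L'`, `𝔤(U)`, `G(U)` and the rank loci in `𝔤(V)` are locally closed. -/

theorem surj_locallyClosed : IsZariskiLocallyClosed K (surj K V U) := by
  refine ⟨∅, Set.range fun (s : U →ₗ[K] V) (X : V →ₗ[K] U) => LinearMap.det (X ∘ₗ s),
    Set.empty_subset _, ?_, ?_⟩
  · rintro _ ⟨s, rfl⟩
    exact polyFun_comp_linear K (LinearMap.lcomp K U s) (det_mem_polyFun K (W := U))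
  · ext X
    simp only [surj, Set.mem_ofPred_eq, Set.mem_empty_iff_false, false_imp_iff, implies_true,
      true_and, Set.exists_range_iff]
    constructor
    · intro hX
      obtain ⟨s, hs⟩ := X.exists_rightInverse_of_surjective (LinearMap.range_eq_top.2 hX)
      exact ⟨s, by simp [hs]⟩
    · rintro ⟨s, hs⟩
      have h := (LinearMap.equivOfDetNeZero _ hs).surjective
      exact fun u => let ⟨a, ha⟩ := h u; ⟨s a, ha⟩

theorem isometries_locallyClosed (B : LinearMap.BilinForm K U) :
    IsZariskiLocallyClosed K (isometries B) := by
  refine ⟨Set.range fun (x : U × U) (g : Module.End K U) => B (g x.1) (g x.2) - B x.1 x.2, {1},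
    ?_, ?_, ?_⟩
  · rintro _ ⟨⟨x, y⟩, rfl⟩
    refine (polyFun K (Module.End K U)).sub_mem (bilin_mem_polyFun K (LinearMap.mk₂ K
      (fun g h : Module.End K U => B (g x) (h y)) ?_ ?_ ?_ ?_))
      ((polyFun K (Module.End K U)).algebraMap_mem (B x y))
    all_goals intros; simp
  · rintro _ rfl
    exact (polyFun K (Module.End K U)).one_mem
  · ext g
    simp only [isometries, LinearMap.IsOrthogonal, Set.mem_ofPred_eq, Set.forall_mem_range,
      Prod.forall, sub_eq_zero, Set.mem_singleton_iff, exists_eq_left, Pi.one_apply, ne_eq,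
      one_ne_zero, not_false_eq_true, and_true]

theorem lieAlg_locallyClosed (B : LinearMap.BilinForm K U) :
    IsZariskiLocallyClosed K (lieAlg B) := by
  refine ⟨Set.range fun (x : U × U) (D : Module.End K U) => B (D x.1) x.2 + B x.1 (D x.2), {1},
    ?_, ?_, ?_⟩
  · rintro _ ⟨⟨x, y⟩, rfl⟩
    refine (polyFun K (Module.End K U)).add_mem
      (linear_mem_polyFun K (B.flip y ∘ₗ (LinearMap.applyₗ x : Module.End K U →ₗ[K] U)))
      (linear_mem_polyFun K (B x ∘ₗ (LinearMap.applyₗ y : Module.End K U →ₗ[K] U)))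
  · rintro _ rfl
    exact (polyFun K (Module.End K U)).one_mem
  · ext D
    simp only [lieAlg, LinearMap.IsSkewAdjoint, LinearMap.IsAdjointPair, Set.mem_ofPred_eq,
      Set.forall_mem_range, Prod.forall, Pi.neg_apply, map_neg, eq_neg_iff_add_eq_zero,
      Set.mem_singleton_iff, exists_eq_left, Pi.one_apply, ne_eq, one_ne_zero,
      not_false_eq_true, and_true]

theorem le_rank_iff (D : Module.End K V) (r : ℕ) :
    r ≤ Module.finrank K (LinearMap.range D) ↔
      ∃ (a : (Fin r → K) →ₗ[K] V) (b : V →ₗ[K] (Fin r → K)), LinearMap.det (b ∘ₗ D ∘ₗ a) ≠ 0 := by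
  constructor
  · intro h
    obtain ⟨v, hv⟩ := exists_linearIndependent_of_le_finrank h
    choose x hx using fun i => (v i).2
    have hlin : LinearIndependent K fun i => D (x i) := by
      have := hv.map' (LinearMap.range D).subtype (Submodule.ker_subtype _)
      simpa [Function.comp_def, hx] using this
    let a : (Fin r → K) →ₗ[K] V := Fintype.linearCombination K x
    have hinj : Function.Injective (D ∘ₗ a) := by
      have h2 : D ∘ₗ a = Fintype.linearCombination K (fun i => D (x i)) := by
        ext i; simp [a]
      rw [h2]
      exact hlin.fintypeLinearCombination_injective
    obtain ⟨b, hb⟩ := LinearMap.exists_leftInverse_of_injective _ (LinearMap.ker_eq_bot.2 hinj)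
    exact ⟨a, b, by simp [hb]⟩
  · rintro ⟨a, b, h⟩
    have hsurj : Function.Surjective (b ∘ₗ (LinearMap.range D).subtype) := by
      intro y
      obtain ⟨z, hz⟩ := (LinearMap.equivOfDetNeZero _ h).surjective y
      exact ⟨⟨D (a z), a z, rfl⟩, hz⟩
    simpa using LinearMap.finrank_le_finrank_of_surjective hsurj

theorem rankLocus_locallyClosed (B : LinearMap.BilinForm K V) (r : ℕ) :
    IsZariskiLocallyClosed K (rankLocus B r) := by
  have hdet : ∀ (k : ℕ) (a : (Fin k → K) →ₗ[K] V) (b : V →ₗ[K] (Fin k → K)),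
      (fun D : Module.End K V => LinearMap.det (b ∘ₗ D ∘ₗ a)) ∈ polyFun K (Module.End K V) := by
    intro k a b
    exact polyFun_comp_linear K
      (LinearMap.lcomp K (Fin k → K) a ∘ₗ LinearMap.llcomp K V V (Fin k → K) b)
      (det_mem_polyFun K (W := Fin k → K))
  obtain ⟨I, J, hI, hJ, h⟩ := lieAlg_locallyClosed B
  have hJ1 : ∀ D, D ∈ lieAlg B ↔ (∀ f ∈ I, f D = 0) ∧ ∃ g ∈ J, g D ≠ 0 := fun D => by
    exact ⟨fun hD => h.subset hD, fun hD => h.superset hD⟩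
  refine ⟨I ∪ Set.range fun (p : ((Fin (r + 1) → K) →ₗ[K] V) × (V →ₗ[K] (Fin (r + 1) → K)))
      (D : Module.End K V) => LinearMap.det (p.2 ∘ₗ D ∘ₗ p.1),
    {f | ∃ g ∈ J, ∃ (a : (Fin r → K) →ₗ[K] V) (b : V →ₗ[K] (Fin r → K)),
      f = fun D => g D * LinearMap.det (b ∘ₗ D ∘ₗ a)}, ?_, ?_, ?_⟩
  · refine Set.union_subset hI ?_
    rintro _ ⟨⟨a, b⟩, rfl⟩
    exact hdet _ a b
  · rintro _ ⟨g, hg, a, b, rfl⟩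
    exact (polyFun K (Module.End K V)).mul_mem (hJ hg) (hdet _ a b)
  · ext D
    have hrank : Module.finrank K (LinearMap.range D) = r ↔
        r ≤ Module.finrank K (LinearMap.range D) ∧
          ¬ r + 1 ≤ Module.finrank K (LinearMap.range D) := by omega
    rw [le_rank_iff, le_rank_iff] at hrank
    push Not at hrank
    change D ∈ lieAlg B ∧ _ ↔ (∀ f ∈ _, _) ∧ ∃ f ∈ _, _
    rw [hJ1, hrank]
    constructor
    · rintro ⟨⟨h1, g, hg, hgD⟩, ⟨a, b, hab⟩, h2⟩
      refine ⟨?_, _, ⟨g, hg, a, b, rfl⟩, mul_ne_zero hgD hab⟩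
      rintro f (hf | ⟨⟨a, b⟩, rfl⟩)
      · exact h1 f hf
      · exact h2 a b
    · rintro ⟨h1, _, ⟨g, hg, a, b, rfl⟩, hne⟩
      exact ⟨⟨fun f hf => h1 f (Or.inl hf), g, hg, left_ne_zero_of_mul hne⟩,
        ⟨a, b, right_ne_zero_of_mul hne⟩, fun a b => h1 _ (Or.inr ⟨(a, b), rfl⟩)⟩

variable [IsAlgClosed K]

/-- The morphism of varieties `π : L' → 𝔤(U)`. -/
def piMor (hε : ε = 1 ∨ ε = -1) (hV : IsQuadraticSpace BV ε) (hU : IsQuadraticSpace BU (-ε)) :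
    variety K (surj_locallyClosed (K := K) (V := V) (U := U)) ⟶
      variety K (lieAlg_locallyClosed BU) :=
  variety.map K _ _ (piMap hV.nondegenerate BU) (piMap_mapsTo hε hV hU)
    (piMap_poly hV.nondegenerate)

/-- The morphism of varieties `ρ|L' : L' → {D ∈ 𝔤(V) | rank D = dim U}`. -/
def rhoMor (hε : ε = 1 ∨ ε = -1) (hV : IsQuadraticSpace BV ε) (hU : IsQuadraticSpace BU (-ε)) :
    variety K (surj_locallyClosed (K := K) (V := V) (U := U)) ⟶
      variety K (rankLocus_locallyClosed BV (Module.finrank K U)) :=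
  variety.map K _ _ (rhoMap hV.nondegenerate BU) (rhoMap_mapsTo hε hV hU)
    (rhoMap_poly hV.nondegenerate)

end Forms

end

end QuadraticPair

/-! After a choice of bases let `J_V`, `J_U` be the Gram matrices. Then `π(X) J_U⁻¹ = X J_V⁻¹ Xᵀ`
and `J_V ρ(X) = Xᵀ J_U X`, so everything reduces to matrix equations for symmetric or alternating
matrices over commutative `K`-algebras.

Smoothness is infinitesimal lifting from `B ⧸ I` to `B` with `I² = 0`. For `π`, one Newton step
solves `X G Xᵀ = E`: a surjective `X` has a right inverse, `2` is invertible, and the error has the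
symmetry type of `G` (`exists_mul_mul_transpose_eq`). For `ρ`, a matrix `S` of rank `m` with `aᵀ S
a` invertible is recovered from `aᵀ S` by `S = S a (aᵀ S a)⁻¹ aᵀ S`; so it suffices to lift the
square matrix `X a` and then to solve a linear equation (`exists_transpose_mul_mul_eq`). The opens
`det (X a) ≠ 0` cover `L'`. Since `L'` is dense in `Hom(V, U)`, every matrix over `B` is a `B`-point
of `K[L']`, and a lift only has to be found as a matrix.

For the images, an element of the Lie algebra of `U` or `V` is a form of the opposite type. `D = X
X*` says that `X*` embeds the form `(D x, y)` of `U` isometrically into `V`; a form with radical `R`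
embeds injectively once `V` has room for its nondegenerate enlargement by the dual of `R`, which is
the bound `rank D ≥ 2m - n` (`exists_injective_isometry`). `D = X* X` says that `X` identifies `V /
ker D`, with the form `(x, D y)`, with `U`; this is possible as quadratic spaces of the same type
and dimension are isometric (`exists_isometry_of_finrank_le`).

For the fibers, a `B`-point of `L'` with the same image under `ρ` as `X` is `g X` for a unique
matrix `g` with `gᵀ J_U g = J_U`. As `G(U)` is the reduced variety, such a `g` has to satisfy all
polynomials that vanish on the isometries over `K`. This is the reducedness of the isometry scheme;
it is proved with the Cayley transform, which parametrizes the scheme near each point by a linear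
space when `2 ≠ 0`. -/

namespace QuadraticPair

noncomputable section

/-! ### Points of `K[S]` with values in a `K`-algebra -/

section Points

variable {K : Type u} [Field K] {W : Type u} [AddCommGroup W] [Module K W]

/-- The restriction of a linear form, as an element of `K[S]`. -/
def linRes (S : Set W) (φ : Module.Dual K W) : coordRing K S :=
  ⟨restrict K S φ, φ, linear_mem_polyFun K φ, rfl⟩

theorem coordRing_algHom_ext {ι B : Type*} [CommRing B] [Algebra K B] (b : Module.Basis ι K W)
    {S : Set W} {χ₁ χ₂ : coordRing K S →ₐ[K] B} [Finite ι]
    (h : ∀ i, χ₁ (linRes S (b.coord i)) = χ₂ (linRes S (b.coord i))) : χ₁ = χ₂ := by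
  have := Fintype.ofFinite ι
  have hlin : ∀ φ, χ₁ (linRes S φ) = χ₂ (linRes S φ) := by
    intro φ
    have : linRes S φ = ∑ i, φ (b i) • linRes S (b.coord i) := by
      apply Subtype.ext
      funext w
      rw [AddSubmonoidClass.coe_finsetSum, Finset.sum_apply]
      change φ w = ∑ i, φ (b i) * b.repr w i
      conv_lhs => rw [← b.sum_repr w, map_sum]
      simp [mul_comm]
    rw [this]
    simp [h]
  ext ⟨_, f, hf, rfl⟩
  have key : ∀ hf' : restrict K S f ∈ coordRing K S, χ₁ ⟨restrict K S f, hf'⟩ =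
      χ₂ ⟨restrict K S f, hf'⟩ := by
    induction hf using Algebra.adjoin_induction with
    | mem x hx => obtain ⟨φ, rfl⟩ := hx; exact fun _ => hlin φ
    | algebraMap r => exact fun _ => (χ₁.commutes r).trans (χ₂.commutes r).symm
    | add x y hx hy ihx ihy =>
      intro _
      have := congrArg₂ (· + ·) (ihx ⟨x, hx, rfl⟩) (ihy ⟨y, hy, rfl⟩)
      rw [← map_add, ← map_add] at this
      exact this
    | mul x y hx hy ihx ihy =>
      intro _
      have := congrArg₂ (· * ·) (ihx ⟨x, hx, rfl⟩) (ihy ⟨y, hy, rfl⟩)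
      rw [← map_mul, ← map_mul] at this
      exact this
  exact key _

/-- Evaluation of polynomials in coordinates as functions on `S`. -/
def polyToCoord {ι : Type*} (b : Module.Basis ι K W) (S : Set W) :
    MvPolynomial ι K →ₐ[K] coordRing K S :=
  MvPolynomial.aeval fun i => linRes S (b.coord i)

theorem polyToCoord_apply {ι : Type*} (b : Module.Basis ι K W) (S : Set W)
    (P : MvPolynomial ι K) (s : S) :
    (polyToCoord b S P).1 s = MvPolynomial.eval (fun i => b.repr s i) P := by
  have : (evalAt K S s).comp (polyToCoord b S) = MvPolynomial.aeval fun i => b.repr s i := by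
    ext i
    simp only [AlgHom.comp_apply, polyToCoord, MvPolynomial.aeval_X]
    rfl
  exact DFunLike.congr_fun this P

theorem polyToCoord_surjective {ι : Type*} [Finite ι] (b : Module.Basis ι K W) (S : Set W) :
    Function.Surjective (polyToCoord b S) := by
  have := Fintype.ofFinite ι
  rintro ⟨_, f, hf, rfl⟩
  induction hf using Algebra.adjoin_induction with
  | mem x hx =>
    obtain ⟨φ, rfl⟩ := hx
    refine ⟨∑ i, φ (b i) • MvPolynomial.X i, ?_⟩
    apply Subtype.ext
    funext w
    rw [polyToCoord_apply]
    simp only [map_sum, MvPolynomial.smul_eval, MvPolynomial.eval_X]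
    change _ = φ w
    conv_rhs => rw [← b.sum_repr w, map_sum]
    simp [mul_comm]
  | algebraMap r => exact ⟨algebraMap _ _ r, (polyToCoord b S).commutes r⟩
  | add x y hx hy ihx ihy =>
    obtain ⟨P, hP⟩ := ihx
    obtain ⟨Q, hQ⟩ := ihy
    exact ⟨P + Q, by rw [map_add, hP, hQ]; rfl⟩
  | mul x y hx hy ihx ihy =>
    obtain ⟨P, hP⟩ := ihx
    obtain ⟨Q, hQ⟩ := ihy
    exact ⟨P * Q, by rw [map_mul, hP, hQ]; rfl⟩

/-- A `B`-point of `K[S]` is a vector at which all polynomials that vanish on `S` vanish. -/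
theorem exists_coordRing_algHom {ι B : Type*} [Finite ι] [CommRing B] [Algebra K B]
    (b : Module.Basis ι K W) (S : Set W) (c : ι → B)
    (h : ∀ P : MvPolynomial ι K, (∀ s ∈ S, MvPolynomial.eval (fun i => b.repr s i) P = 0) →
      MvPolynomial.aeval c P = 0) :
    ∃ χ : coordRing K S →ₐ[K] B, ∀ i, χ (linRes S (b.coord i)) = c i := by
  refine ⟨AlgHom.liftOfSurjective (polyToCoord b S) (polyToCoord_surjective b S)
    (MvPolynomial.aeval c) ?_, fun i => ?_⟩
  · intro P hP
    refine h P fun s hs => ?_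
    rw [← polyToCoord_apply b S P ⟨s, hs⟩]
    rw [RingHom.mem_ker] at hP
    exact congrFun (congrArg Subtype.val hP) _
  · have : linRes S (b.coord i) = polyToCoord b S (MvPolynomial.X i) := by simp [polyToCoord]
    rw [this]
    exact (AlgHom.liftOfSurjective_apply _ _ _ _ _).trans (MvPolynomial.aeval_X _ _)

/-- Polynomials in coordinates define polynomial functions. -/
theorem exists_mvPolynomial_of_mem_polyFun {ι : Type*} [Finite ι] (b : Module.Basis ι K W)
    {f : W → K} (hf : f ∈ polyFun K W) :
    ∃ P : MvPolynomial ι K, ∀ w, f w = MvPolynomial.eval (fun i => b.repr w i) P := by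
  obtain ⟨P, hP⟩ := polyToCoord_surjective b Set.univ ⟨restrict K _ f, f, hf, rfl⟩
  refine ⟨P, fun w => ?_⟩
  rw [← polyToCoord_apply b Set.univ P ⟨w, trivial⟩, hP]
  rfl

/-- A polynomial that vanishes where a nonzero polynomial function does not is zero. -/
theorem eq_zero_of_eval_eq_zero_of_ne_zero [Infinite K] {ι : Type*} (P Q : MvPolynomial ι K)
    (hQ : ∃ x, MvPolynomial.eval x Q ≠ 0)
    (h : ∀ x, MvPolynomial.eval x Q ≠ 0 → MvPolynomial.eval x P = 0) : P = 0 := by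
  have h0 : P * Q = 0 := by
    apply MvPolynomial.funext
    intro x
    by_cases hx : MvPolynomial.eval x Q = 0
    · simp [hx]
    · simp [h x hx]
  obtain ⟨x, hx⟩ := hQ
  rcases mul_eq_zero.1 h0 with h1 | h1
  · exact h1
  · simp [h1] at hx

end Points

/-! ### Generic matrices and density of the surjective maps -/

section GenericMatrix

variable {K : Type u} [Field K] {V U : Type u} [AddCommGroup V] [Module K V]
  [AddCommGroup U] [Module K U] {m n : Type} [Fintype m] [Fintype n] [DecidableEq m]
  [DecidableEq n] (bV : Module.Basis n K V) (bU : Module.Basis m K U)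

/-- The basis of `Hom(V, U)` whose coordinates are the matrix entries. -/
def homBasis : Module.Basis (m × n) K (V →ₗ[K] U) :=
  (Matrix.stdBasis K m n).map (LinearMap.toMatrix bV bU).symm

theorem homBasis_repr (X : V →ₗ[K] U) (ij : m × n) :
    (homBasis bV bU).repr X ij = LinearMap.toMatrix bV bU X ij.1 ij.2 := by
  obtain ⟨i, j⟩ := ij
  have := (Matrix.stdBasis K m n).sum_repr (LinearMap.toMatrix bV bU X)
  conv_rhs => rw [← this]
  simp only [homBasis, Module.Basis.map_repr, LinearEquiv.symm_symm, LinearEquiv.trans_apply,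
    Matrix.sum_apply, Matrix.smul_apply, smul_eq_mul]
  rw [Finset.sum_eq_single (i, j)]
  · simp [Matrix.stdBasis_eq_single]
  · rintro ⟨i', j'⟩ - hne
    rw [Matrix.stdBasis_eq_single, Matrix.single_apply_of_ne, mul_zero]
    rintro ⟨rfl, rfl⟩
    exact hne rfl
  · simp

/-- The generic matrix of a point of `S ⊆ Hom(V, U)`, with entries in `K[S]`. -/
def genMat (S : Set (V →ₗ[K] U)) : Matrix m n (coordRing K S) :=
  Matrix.of fun i j => linRes S ((homBasis bV bU).coord (i, j))

theorem genMat_map_evalAt (S : Set (V →ₗ[K] U)) (s : S) :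
    (genMat bV bU S).map (evalAt K S s) = LinearMap.toMatrix bV bU s := by
  ext i j
  exact homBasis_repr bV bU s (i, j)

/-- Identities between matrices over `K[S]` can be checked at the points of `S`. -/
theorem matrix_coordRing_ext {W : Type u} [AddCommGroup W] [Module K W] {S : Set W}
    {k l : Type*} {M N : Matrix k l (coordRing K S)}
    (h : ∀ s : S, M.map (evalAt K S s) = N.map (evalAt K S s)) : M = N := by
  ext i j : 1
  apply Subtype.ext
  funext s
  exact congrFun (congrFun (h s) i) j

/-- The matrix entries generate `K[S]`. With the next lemma this identifies the `B`-points of `K[S]`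
with the matrices over `B` that satisfy every equation of `S`. -/
theorem genMat_algHom_ext {B : Type*} [CommRing B] [Algebra K B] {S : Set (V →ₗ[K] U)}
    {χ₁ χ₂ : coordRing K S →ₐ[K] B}
    (h : (genMat bV bU S).map χ₁ = (genMat bV bU S).map χ₂) : χ₁ = χ₂ :=
  coordRing_algHom_ext (homBasis bV bU) fun ⟨i, j⟩ => congrFun (congrFun h i) j

theorem exists_algHom_genMat {B : Type*} [CommRing B] [Algebra K B] (S : Set (V →ₗ[K] U))
    (M : Matrix m n B)
    (h : ∀ P : MvPolynomial (m × n) K,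
      (∀ s ∈ S, MvPolynomial.eval (fun ij => LinearMap.toMatrix bV bU s ij.1 ij.2) P = 0) →
      MvPolynomial.aeval (fun ij => M ij.1 ij.2) P = 0) :
    ∃ χ : coordRing K S →ₐ[K] B, (genMat bV bU S).map χ = M := by
  obtain ⟨χ, hχ⟩ := exists_coordRing_algHom (homBasis bV bU) S (fun ij => M ij.1 ij.2)
    (by simpa only [homBasis_repr] using h)
  exact ⟨χ, by ext i j; exact hχ (i, j)⟩

theorem exists_surjective_of_finrank_le [FiniteDimensional K V] [FiniteDimensional K U]
    (hdim : Module.finrank K U ≤ Module.finrank K V) :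
    ∃ X : V →ₗ[K] U, Function.Surjective X := by
  let a := Module.finBasis K V
  let b := Module.finBasis K U
  refine ⟨a.constr K fun i => if h : i.1 < Module.finrank K U then b ⟨i, h⟩ else 0, ?_⟩
  rw [← LinearMap.range_eq_top, eq_top_iff, ← b.span_eq, Submodule.span_le]
  rintro _ ⟨i, rfl⟩
  exact ⟨a (Fin.castLE hdim i), by rw [Module.Basis.constr_basis]; simp⟩

/-- The surjective maps are dense in `Hom(V, U)`, so that every matrix is a point of the
coordinate ring. -/
theorem exists_algHom_genMat_surj [Infinite K] [FiniteDimensional K V] [FiniteDimensional K U]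
    (hdim : Module.finrank K U ≤ Module.finrank K V)
    {B : Type*} [CommRing B] [Algebra K B] (M : Matrix m n B) :
    ∃ χ : coordRing K (surj K V U) →ₐ[K] B, (genMat bV bU (surj K V U)).map χ = M := by
  refine exists_algHom_genMat bV bU _ M fun P hP => ?_
  obtain ⟨X₀, hX₀⟩ := exists_surjective_of_finrank_le hdim
  obtain ⟨s, hs⟩ := X₀.exists_rightInverse_of_surjective (LinearMap.range_eq_top.2 hX₀)
  -- `Q` is `X ↦ det (X s)`. It equals `1` at `X₀`, and its nonvanishing forces `X` to be
  -- surjective; so a polynomial that vanishes on the surjective maps is zero and imposes no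
  -- condition on `M`.
  obtain ⟨Q, hQ⟩ := exists_mvPolynomial_of_mem_polyFun (homBasis bV bU)
    (polyFun_comp_linear K (LinearMap.lcomp K U s) (det_mem_polyFun K (W := U)))
  simp only [homBasis_repr] at hQ
  rw [eq_zero_of_eval_eq_zero_of_ne_zero P Q ⟨_, ?_⟩ fun x hx => ?_, map_zero]
  · exact fun ij => LinearMap.toMatrix bV bU X₀ ij.1 ij.2
  · rw [← hQ]
    simp [LinearMap.lcomp_apply', hs]
  · have hX := LinearMap.toMatrix_toLin bV bU (Matrix.of fun i j => x (i, j))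
    set X := Matrix.toLin bV bU (Matrix.of fun i j => x (i, j))
    have hx' : (fun ij : m × n => LinearMap.toMatrix bV bU X ij.1 ij.2) = x := by
      rw [hX]; rfl
    rw [← hx'] at hx ⊢
    refine hP X ?_
    rw [← hQ] at hx
    have h := (LinearMap.equivOfDetNeZero _ hx).surjective
    exact fun u => let ⟨a, ha⟩ := h u; ⟨s a, ha⟩

end GenericMatrix

/-! ### The infinitesimal criterion for smoothness -/

section SmoothAlgebra

/-- Square-zero lifting for algebras over a base field implies smoothness. -/
theorem smooth_away_of_lift {K R A : Type u} [Field K] [CommRing R] [CommRing A] [Algebra K R]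
    [Algebra K A] [Algebra.FiniteType K R] [Algebra.FiniteType K A] (φ : R →ₐ[K] A) (h : A)
    (H : ∀ (B : Type u) [CommRing B] [Algebra K B] (I : Ideal B), I ^ 2 = ⊥ →
      ∀ (τ : R →ₐ[K] B) (σ : A →ₐ[K] B ⧸ I), (Ideal.Quotient.mkₐ K I).comp τ = σ.comp φ →
        IsUnit (σ h) → ∃ σ' : A →ₐ[K] B, (Ideal.Quotient.mkₐ K I).comp σ' = σ ∧ σ'.comp φ = τ) :
    ((algebraMap A (Localization.Away h)).comp φ.toRingHom).Smooth := by
  have : IsNoetherianRing R := Algebra.FiniteType.isNoetherianRing K R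
  rw [RingHom.smooth_def]
  constructor
  · let := ((algebraMap A (Localization.Away h)).comp φ.toRingHom).toAlgebra
    change Algebra.FormallySmooth R (Localization.Away h)
    have hR : ∀ r : R, algebraMap R (Localization.Away h) r =
      algebraMap A (Localization.Away h) (φ r) := fun r => rfl
    refine Algebra.FormallySmooth.of_comp_surjective fun B _ _ I hI g => ?_
    let : Algebra K B := ((algebraMap R B).comp (algebraMap K R)).toAlgebra
    have : IsScalarTower K R B := IsScalarTower.of_algebraMap_eq fun _ => rfl
    let τ : R →ₐ[K] B := IsScalarTower.toAlgHom K R B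
    let σ : A →ₐ[K] B ⧸ I :=
      { toRingHom := (g : Localization.Away h →+* B ⧸ I).comp (algebraMap A _)
        commutes' := fun r => by
          have h1 := g.commutes (algebraMap K R r)
          rw [hR, φ.commutes] at h1
          exact h1 }
    have hσ : ∀ a, σ a = g (algebraMap A _ a) := fun _ => rfl
    obtain ⟨σ', h1, h2⟩ := H B I hI τ σ (by
      ext r
      exact (g.commutes r).symm) (by
      rw [hσ]; exact (IsLocalization.Away.algebraMap_isUnit h).map g)
    -- Units lift along the nilpotent ideal `I`, so the lift on `A` extends to the localization.
    have hu : IsUnit (σ' h) := by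
      have : IsUnit (Ideal.Quotient.mk I (σ' h)) := by
        have h3 := DFunLike.congr_fun h1 h
        change Ideal.Quotient.mk I (σ' h) = σ h at h3
        rw [h3, hσ]
        exact (IsLocalization.Away.algebraMap_isUnit h).map g
      exact (IsNilpotent.isUnit_quotient_mk_iff ⟨2, hI⟩).1 this
    refine ⟨{ toRingHom := IsLocalization.Away.lift h (g := σ'.toRingHom) hu
              commutes' := fun r => ?_ }, ?_⟩
    · change IsLocalization.Away.lift h hu (algebraMap A _ (φ r)) = _
      rw [IsLocalization.Away.lift_eq]
      exact DFunLike.congr_fun h2 r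
    · apply AlgHom.coe_ringHom_injective
      refine IsLocalization.ringHom_ext (Submonoid.powers h) ?_
      ext a
      change Ideal.Quotient.mk I (IsLocalization.Away.lift h hu (algebraMap A _ a)) = _
      rw [IsLocalization.Away.lift_eq]
      exact DFunLike.congr_fun h1 a
  -- Over the noetherian ring `R` finite type suffices for finite presentation.
  · rw [← RingHom.FinitePresentation.of_finiteType]
    refine RingHom.FiniteType.comp ?_ ?_
    · rw [RingHom.finiteType_algebraMap]
      infer_instance
    · refine RingHom.FiniteType.of_comp_finiteType (f := algebraMap K R) ?_
      rw [show φ.toRingHom.comp (algebraMap K R) = algebraMap K A from φ.comp_algebraMap,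
        RingHom.finiteType_algebraMap]
      infer_instance

end SmoothAlgebra

/-! ### Lifting solutions of `X G Xᵀ = E` and `Xᵀ J X = S` -/

section Newton

variable {B C : Type*} [CommRing B] [CommRing C] (q : B →+* C) {m n : Type*} [Fintype m]
  [Fintype n] [DecidableEq m] [DecidableEq n]

theorem mul_eq_zero_of_map_eq_zero {q : B →+* C} (hq : ∀ x y, q x = 0 → q y = 0 → x * y = 0)
    {k l : Type*} {M : Matrix k m B} {N : Matrix m l B} (hM : M.map q = 0) (hN : N.map q = 0) :
    M * N = 0 := by
  ext i j
  exact Finset.sum_eq_zero fun x _ => hq _ _ (congrFun (congrFun hM i) x) (congrFun (congrFun hN x) j)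

/-- One step of Newton's method solves `X G Xᵀ = E` modulo a square-zero ideal. -/
theorem exists_mul_mul_transpose_eq {q : B →+* C}
    (hq : ∀ x y, q x = 0 → q y = 0 → x * y = 0) (h2 : IsUnit (2 : B)) {ε : B}
    (hε : ε * ε = 1) {G : Matrix n n B} (hG : IsUnit G) (hGT : G.transpose = ε • G)
    {E : Matrix m m B} (hE : E.transpose = ε • E) (X : Matrix m n B) (s : Matrix n m B)
    (hs : X * s = 1) (hX : (X * G * X.transpose).map q = E.map q) :
    ∃ Y : Matrix m n B, Y.map q = X.map q ∧ Y * G * Y.transpose = E := by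
  obtain ⟨c, hc⟩ := h2.exists_right_inv
  obtain ⟨H, hH⟩ := hG.exists_left_inv
  set Δ := E - X * G * X.transpose with hΔ
  have hΔT : Δ.transpose = ε • Δ := by
    rw [hΔ, Matrix.transpose_sub, hE, Matrix.transpose_mul, Matrix.transpose_mul,
      Matrix.transpose_transpose, hGT, smul_sub, Matrix.mul_assoc X G, Matrix.smul_mul,
      Matrix.mul_smul]
  have hΔq : Δ.map q = 0 := by
    rw [hΔ, Matrix.map_sub _ (map_sub q), hX, sub_self]
  -- The linearized equation is `Y G Xᵀ + X G Yᵀ = Δ`. The two terms are `ε`-transposes of each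
  -- other, so it is enough that the first is `Δ / 2`; multiplying `Δ / 2` by `sᵀ G⁻¹` achieves this
  -- because `(X s)ᵀ = 1`.
  obtain ⟨Y, hY⟩ : ∃ Y : Matrix m n B, Y = Δ * (c • (s.transpose * H)) := ⟨_, rfl⟩
  have hYq : Y.map q = 0 := by
    rw [hY, Matrix.map_mul, hΔq, Matrix.zero_mul]
  have h1 : Y * G * X.transpose = c • Δ := by
    rw [hY, Matrix.mul_smul, Matrix.smul_mul, Matrix.smul_mul, Matrix.mul_assoc, Matrix.mul_assoc, Matrix.mul_assoc,
      ← Matrix.mul_assoc H, hH, Matrix.one_mul, ← Matrix.transpose_mul, hs, Matrix.transpose_one,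
      Matrix.mul_one]
  have h1' : X * G * Y.transpose = c • Δ := by
    have h3 := congrArg Matrix.transpose h1
    rw [Matrix.transpose_mul, Matrix.transpose_mul, Matrix.transpose_transpose, hGT,
      Matrix.transpose_smul, hΔT, Matrix.smul_mul, Matrix.mul_smul, smul_comm c] at h3
    have h4 := congrArg (ε • ·) h3
    simp only [smul_smul, hε, one_smul] at h4
    rw [Matrix.mul_assoc, h4, ← mul_assoc, hε, one_mul]
  -- The quadratic term vanishes, so a single Newton step is exact.
  have h4 : Y * G * Y.transpose = 0 := by
    rw [Matrix.mul_assoc]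
    refine mul_eq_zero_of_map_eq_zero hq hYq ?_
    rw [Matrix.map_mul, Matrix.transpose_map, hYq, Matrix.transpose_zero, Matrix.mul_zero]
  refine ⟨X + Y, by rw [Matrix.map_add _ (map_add q), hYq, add_zero], ?_⟩
  rw [Matrix.transpose_add, Matrix.add_mul, Matrix.add_mul, Matrix.mul_add, Matrix.mul_add, h1, h1',
    h4, add_zero, add_assoc, ← add_smul, ← two_mul, hc, one_smul, hΔ, add_sub_cancel]

/-- Lifting of factorizations `S = Xᵀ J X` modulo a square-zero ideal, for `S` of rank `m`
(expressed by `hrel`) with an invertible minor. -/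
theorem exists_transpose_mul_mul_eq {q : B →+* C}
    (hq : ∀ x y, q x = 0 → q y = 0 → x * y = 0) (hunit : ∀ x, IsUnit (q x) → IsUnit x)
    (h2 : IsUnit (2 : B)) {η : B} (hη : η * η = 1) {J : Matrix m m B} (hJ : IsUnit J)
    (hJT : J.transpose = η • J) {S : Matrix n n B} (hS : S.transpose = η • S)
    (X : Matrix m n B) (a : Matrix n m B) (ha : IsUnit (X * a).det)
    (hrel : S * a * (a.transpose * S * a).adjugate * (a.transpose * S) =
      (a.transpose * S * a).det • S)
    (hX : (X.transpose * J * X).map q = S.map q) :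
    ∃ Y : Matrix m n B, Y.map q = X.map q ∧ Y.transpose * J * Y = S := by
  set P := a.transpose * S * a with hP
  have hPT : P.transpose = η • P := by
    rw [hP, Matrix.transpose_mul, Matrix.transpose_mul, Matrix.transpose_transpose, hS,
      Matrix.smul_mul, Matrix.mul_smul, Matrix.mul_assoc]
  have haS : (X * a).transpose.map q * J.map q * X.map q = (a.transpose * S).map q := by
    rw [Matrix.map_mul, ← hX, ← Matrix.map_mul, ← Matrix.map_mul, ← Matrix.map_mul,
      Matrix.transpose_mul, Matrix.mul_assoc, Matrix.mul_assoc, Matrix.mul_assoc]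
  -- The compressed equation `(X a)ᵀ J (X a) = P` has an invertible square unknown and falls under
  -- the previous lemma; `Z` is the corrected `(X a)ᵀ`.
  obtain ⟨Z, hZ, hZJ⟩ := exists_mul_mul_transpose_eq hq h2 hη hJ hJT hPT (X * a).transpose
    (X * a)⁻¹.transpose
    (by rw [← Matrix.transpose_mul, Matrix.nonsing_inv_mul _ ha, Matrix.transpose_one])
    (by
      rw [Matrix.transpose_transpose, hP,
        show (a.transpose * S * a).map q = (a.transpose * S).map q * a.map q from Matrix.map_mul,
        ← haS,
        ← Matrix.map_mul, ← Matrix.map_mul, ← Matrix.map_mul, Matrix.mul_assoc _ X a])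
  have hdetZ : IsUnit Z.det := by
    apply hunit
    rw [RingHom.map_det, RingHom.mapMatrix_apply, hZ, ← RingHom.mapMatrix_apply,
      ← RingHom.map_det, Matrix.det_transpose]
    exact ha.map q
  have hdetJ : IsUnit J.det := (Matrix.isUnit_iff_isUnit_det J).1 hJ
  set L := Z * J with hL
  have hdetL : IsUnit L.det := by rw [hL, Matrix.det_mul]; exact hdetZ.mul hdetJ
  have hdetP : IsUnit P.det := by
    rw [← hZJ, Matrix.det_mul, Matrix.det_transpose]; exact hdetL.mul hdetZ
  have hLi : L⁻¹ * L = 1 := Matrix.nonsing_inv_mul _ hdetL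
  have hLi' : L * L⁻¹ = 1 := Matrix.mul_nonsing_inv _ hdetL
  -- A solution `Y` with `(Y a)ᵀ = Z` must satisfy `Z J Y = aᵀ S`, which determines it.
  refine ⟨L⁻¹ * (a.transpose * S), ?_, ?_⟩
  · rw [Matrix.map_mul, ← haS, ← hZ, ← Matrix.map_mul, ← hL, ← Matrix.mul_assoc,
      ← Matrix.map_mul, hLi, Matrix.map_one _ (map_zero q) (map_one q), Matrix.one_mul]
  -- This gives `L⁻ᵀ J L⁻¹ = η P⁻¹`, so `Yᵀ J Y = S a P⁻¹ aᵀ S`, and `hrel` says that this is `S`.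
  · have h1 : L⁻¹.transpose * J * L⁻¹ * P = η • 1 := by
      rw [← hZJ, Matrix.mul_assoc _ L⁻¹, ← Matrix.mul_assoc L⁻¹, hLi, Matrix.one_mul,
        Matrix.mul_assoc]
      have h5 : J * Z.transpose = η • L.transpose := by
        rw [hL, Matrix.transpose_mul, hJT, Matrix.smul_mul, smul_smul, hη, one_smul]
      rw [h5, Matrix.mul_smul, ← Matrix.transpose_mul, hLi', Matrix.transpose_one]
    have h2 : P.det • (L⁻¹.transpose * J * L⁻¹) = η • P.adjugate := by
      have h6 := congrArg (· * P.adjugate) h1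
      simp only [Matrix.mul_assoc, Matrix.mul_adjugate, Matrix.mul_smul, Matrix.mul_one,
        Matrix.smul_mul, Matrix.one_mul] at h6
      rw [← h6, Matrix.mul_assoc]
    have h3 : P.det • ((L⁻¹ * (a.transpose * S)).transpose * J * (L⁻¹ * (a.transpose * S))) =
        P.det • S := by
      rw [← hrel]
      have h7 : (L⁻¹ * (a.transpose * S)).transpose * J * (L⁻¹ * (a.transpose * S)) =
          η • (S * a * (L⁻¹.transpose * J * L⁻¹) * (a.transpose * S)) := by
        simp only [Matrix.transpose_mul, Matrix.transpose_transpose, hS, Matrix.smul_mul,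
          Matrix.mul_assoc]
      have h8 : P.det • (S * a * (L⁻¹.transpose * J * L⁻¹) * (a.transpose * S)) =
          S * a * (P.det • (L⁻¹.transpose * J * L⁻¹)) * (a.transpose * S) := by
        rw [Matrix.mul_smul, Matrix.smul_mul]
      rw [h7, smul_comm, h8, h2, Matrix.mul_smul, Matrix.smul_mul, smul_smul, hη, one_smul]
    obtain ⟨d, hd⟩ := hdetP.exists_left_inv
    have h8 := congrArg (d • ·) h3
    simpa only [smul_smul, hd, one_smul] using h8

/-- The identity satisfied by the Gram matrices `Xᵀ J X` of `m × n` matrices. -/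
theorem gram_mul_adjugate_mul (J : Matrix m m B) (X : Matrix m n B) (a : Matrix n m B) :
    (X.transpose * J * X) * a * (a.transpose * (X.transpose * J * X) * a).adjugate *
      (a.transpose * (X.transpose * J * X)) =
      (a.transpose * (X.transpose * J * X) * a).det • (X.transpose * J * X) := by
  have hP : a.transpose * (X.transpose * J * X) * a = (X * a).transpose * J * (X * a) := by
    simp only [Matrix.transpose_mul, Matrix.mul_assoc]
  rw [hP]
  set Y := X * a with hY
  have h1 : X.transpose * J * X * a = X.transpose * J * Y := by rw [hY, Matrix.mul_assoc]
  have h2 : a.transpose * (X.transpose * J * X) = Y.transpose * (J * X) := by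
    simp only [hY, Matrix.transpose_mul, Matrix.mul_assoc]
  -- The identity is `S = S a (aᵀ S a)⁻¹ aᵀ S` with the denominator cleared. The adjugate form also
  -- holds where `aᵀ S a` is singular, hence on the whole rank locus.
  rw [h1, h2, Matrix.adjugate_mul_distrib, Matrix.adjugate_mul_distrib, Matrix.det_mul,
    Matrix.det_mul, Matrix.det_transpose]
  calc X.transpose * J * Y * (Y.adjugate * (J.adjugate * Y.transpose.adjugate)) *
        (Y.transpose * (J * X))
      = X.transpose * J * ((Y * Y.adjugate) * J.adjugate * (Y.transpose.adjugate * Y.transpose)) *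
        (J * X) := by simp only [Matrix.mul_assoc]
    _ = (Y.det * J.det * Y.det) • (X.transpose * J * X) := by
      rw [Matrix.mul_adjugate, Matrix.adjugate_mul, Matrix.det_transpose]
      simp only [Matrix.smul_mul, Matrix.mul_smul, Matrix.one_mul, Matrix.mul_one]
      rw [Matrix.mul_assoc (X.transpose * J), ← Matrix.mul_assoc J.adjugate, Matrix.adjugate_mul]
      simp only [Matrix.smul_mul, Matrix.mul_smul, Matrix.one_mul, smul_smul]
      congr 1
      ring

end Newton

/-! ### Matrices of adjoints, `π`, `ρ` and Lie algebra elements -/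

section MatrixDictionary

variable {K : Type u} [Field K]

theorem map_algebraMap_map {A B F m n : Type*} [CommRing A] [Algebra K A] [CommRing B] [Algebra K B]
    [FunLike F A B] [AlgHomClass F K A B] (χ : F) (M : Matrix m n K) :
    (M.map (algebraMap K A)).map χ = M.map (algebraMap K B) := by
  ext i j
  simp [AlgHomClass.commutes χ]

theorem matrix_smul_map {A B F m n : Type*} [CommRing A] [CommRing B] [FunLike F A B]
    [RingHomClass F A B] (χ : F) (c : A) (M : Matrix m n A) : (c • M).map χ = χ c • M.map χ := by
  ext i j
  simp

theorem exists_matrix_map_eq {A B m n : Type*} {q : A → B} (hq : Function.Surjective q)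
    (M : Matrix m n B) : ∃ N : Matrix m n A, N.map q = M := by
  choose f hf using hq
  exact ⟨M.map f, by ext; simp [hf]⟩

theorem isUnit_map_algebraMap {B m : Type*} [CommRing B] [Algebra K B] [Fintype m] [DecidableEq m]
    {M : Matrix m m K} (hM : IsUnit M) : IsUnit (M.map (algebraMap K B)) :=
  hM.map (algebraMap K B).mapMatrix

variable {V U : Type u} [AddCommGroup V] [Module K V]
  [FiniteDimensional K V] [AddCommGroup U] [Module K U] [FiniteDimensional K U]
  {BV : LinearMap.BilinForm K V} {BU : LinearMap.BilinForm K U} {ε : K}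
  {m n : Type} [Fintype m] [Fintype n] [DecidableEq m]
  [DecidableEq n] (bV : Module.Basis n K V) (bU : Module.Basis m K U)

open LinearMap in
theorem isUnit_gram (hV : BV.Nondegenerate) : IsUnit (toMatrix₂ bV bV BV) := by
  rw [Matrix.isUnit_iff_isUnit_det, isUnit_iff_ne_zero]
  exact (BilinForm.nondegenerate_iff_det_ne_zero bV).1 hV

open LinearMap in
theorem gram_transpose (hV : IsQuadraticSpace BV ε) :
    (toMatrix₂ bV bV BV).transpose = ε • toMatrix₂ bV bV BV := by
  ext i j
  simp [toMatrix₂_apply, hV.symm (bV j) (bV i)]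

open LinearMap in
theorem gram_inv_transpose (hε : ε = 1 ∨ ε = -1) (hV : IsQuadraticSpace BV ε) :
    ((toMatrix₂ bV bV BV)⁻¹).transpose = ε • (toMatrix₂ bV bV BV)⁻¹ := by
  rw [Matrix.transpose_nonsing_inv, gram_transpose bV hV]
  have hu := (Matrix.isUnit_iff_isUnit_det _).1 (isUnit_gram bV hV.nondegenerate)
  have hεε : ε * ε = 1 := by rcases hε with rfl | rfl <;> simp
  refine Matrix.inv_eq_right_inv ?_
  rw [Matrix.smul_mul, Matrix.mul_smul, Matrix.mul_nonsing_inv _ hu, smul_smul, hεε, one_smul]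

open LinearMap in
theorem toMatrix_adj (hV : BV.Nondegenerate) (X : V →ₗ[K] U) :
    toMatrix bU bV (adj hV BU X) =
      (toMatrix₂ bV bV BV)⁻¹ * (toMatrix bV bU X).transpose * toMatrix₂ bU bU BU := by
  have h : (toMatrix bV bU X).transpose * toMatrix₂ bU bU BU =
      toMatrix₂ bV bV BV * toMatrix bU bV (adj hV BU X) := by
    rw [← toMatrix₂_comp, ← toMatrix₂_compl₂]
    congr 1
    ext v u
    exact adj_spec hV BU X v u
  have hu := (Matrix.isUnit_iff_isUnit_det _).1 (isUnit_gram bV hV)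
  rw [Matrix.mul_assoc, h, ← Matrix.mul_assoc, Matrix.nonsing_inv_mul _ hu, Matrix.one_mul]

open LinearMap in
theorem toMatrix_piMap (hV : BV.Nondegenerate) (X : V →ₗ[K] U) :
    toMatrix bU bU (piMap hV BU X) = toMatrix bV bU X * (toMatrix₂ bV bV BV)⁻¹ *
      (toMatrix bV bU X).transpose * toMatrix₂ bU bU BU := by
  rw [piMap, toMatrix_comp bU bV bU, toMatrix_adj]
  simp only [Matrix.mul_assoc]

open LinearMap in
-- Multiplication by the Gram matrix turns `ρ(X)` into the pullback to `V` of the form of `U` along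
-- `X`.
theorem toMatrix_rhoMap (hV : BV.Nondegenerate) (X : V →ₗ[K] U) :
    toMatrix₂ bV bV BV * toMatrix bV bV (rhoMap hV BU X) =
      (toMatrix bV bU X).transpose * toMatrix₂ bU bU BU * toMatrix bV bU X := by
  have hu := (Matrix.isUnit_iff_isUnit_det _).1 (isUnit_gram bV hV)
  rw [rhoMap, toMatrix_comp bV bU bV, toMatrix_adj]
  simp only [← Matrix.mul_assoc, Matrix.mul_nonsing_inv _ hu, Matrix.one_mul]

open LinearMap in
-- Skew-adjointness reverses the symmetry type: `(x, D y)` is a form of type `-ε`. The next lemma is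
-- the dual version, for the form on the dual space that `D` defines.
theorem gram_mul_lieAlg_transpose (hV : IsQuadraticSpace BV ε)
    {D : Module.End K V} (hD : D ∈ lieAlg BV) :
    (toMatrix₂ bV bV BV * toMatrix bV bV D).transpose =
      (-ε) • (toMatrix₂ bV bV BV * toMatrix bV bV D) := by
  rw [← toMatrix₂_compl₂]
  ext i j
  have := hD (bV i) (bV j)
  have h2 := hV.symm (bV j) (D (bV i))
  simp_all [toMatrix₂_apply]

open LinearMap in
theorem lieAlg_mul_gram_inv_transpose (hε : ε = 1 ∨ ε = -1) (hV : IsQuadraticSpace BV ε)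
    {D : Module.End K V} (hD : D ∈ lieAlg BV) :
    (toMatrix bV bV D * (toMatrix₂ bV bV BV)⁻¹).transpose =
      (-ε) • (toMatrix bV bV D * (toMatrix₂ bV bV BV)⁻¹) := by
  have hu := (Matrix.isUnit_iff_isUnit_det _).1 (isUnit_gram bV hV.nondegenerate)
  have h := gram_mul_lieAlg_transpose bV hV hD
  have hi := gram_inv_transpose bV hε hV
  set J := toMatrix₂ bV bV BV
  set M := toMatrix bV bV D
  have h1 : M * J⁻¹ = J⁻¹ * (J * M) * J⁻¹ := by
    rw [← Matrix.mul_assoc, Matrix.nonsing_inv_mul _ hu, Matrix.one_mul]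
  rw [h1, Matrix.transpose_mul, Matrix.transpose_mul, h, hi]
  have hεε : ε * ε = 1 := by rcases hε with rfl | rfl <;> simp
  simp only [Matrix.smul_mul, Matrix.mul_smul, smul_smul, Matrix.mul_assoc]
  congr 1
  linear_combination (-ε) * hεε

end MatrixDictionary

/-! ### Infinitesimal lifting for `π` -/

section Lifting

variable {K : Type u} [Field K] [IsAlgClosed K] {V U : Type u} [AddCommGroup V] [Module K V]
  [FiniteDimensional K V] [AddCommGroup U] [Module K U] [FiniteDimensional K U]
  {BV : LinearMap.BilinForm K V} {BU : LinearMap.BilinForm K U} {ε : K}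
  {m n : Type} [Fintype m] [Fintype n] [DecidableEq m]
  [DecidableEq n] (bV : Module.Basis n K V) (bU : Module.Basis m K U)

/-- The comorphism of `π : L' → 𝔤(U)`. -/
def piComorphism (hε : ε = 1 ∨ ε = -1) (hV : IsQuadraticSpace BV ε)
    (hU : IsQuadraticSpace BU (-ε)) :
    coordRing K (lieAlg BU) →ₐ[K] coordRing K (surj K V U) :=
  comorphism K (piMap hV.nondegenerate BU) (piMap_mapsTo hε hV hU) (piMap_poly hV.nondegenerate)

/-- The comorphism of `ρ : L' → ρ(L')`. -/
def rhoComorphism (hε : ε = 1 ∨ ε = -1) (hV : IsQuadraticSpace BV ε)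
    (hU : IsQuadraticSpace BU (-ε)) :
    coordRing K (rankLocus BV (Module.finrank K U)) →ₐ[K] coordRing K (surj K V U) :=
  comorphism K (rhoMap hV.nondegenerate BU) (rhoMap_mapsTo hε hV hU)
    (rhoMap_poly hV.nondegenerate)

open LinearMap in
theorem genMat_map_piComorphism (hε : ε = 1 ∨ ε = -1) (hV : IsQuadraticSpace BV ε)
    (hU : IsQuadraticSpace BU (-ε)) :
    (genMat bU bU (lieAlg BU)).map (piComorphism hε hV hU) =
      genMat bV bU (surj K V U) * ((toMatrix₂ bV bV BV)⁻¹).map (algebraMap K (coordRing K (surj K V U))) *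
        (genMat bV bU (surj K V U)).transpose * (toMatrix₂ bU bU BU).map (algebraMap K (coordRing K (surj K V U))) := by
  refine matrix_coordRing_ext fun s => ?_
  rw [Matrix.map_mul, Matrix.map_mul, Matrix.map_mul, map_algebraMap_map, map_algebraMap_map,
    Matrix.transpose_map, genMat_map_evalAt, Algebra.algebraMap_self]
  change _ = _ * ((toMatrix₂ bV bV BV)⁻¹).map id * _ * (toMatrix₂ bU bU BU).map id
  rw [Matrix.map_id, Matrix.map_id, ← toMatrix_piMap]
  exact genMat_map_evalAt bU bU (lieAlg BU) ⟨_, piMap_mapsTo hε hV hU s.2⟩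

open LinearMap in
theorem gram_mul_genMat_map_rhoComorphism (hε : ε = 1 ∨ ε = -1) (hV : IsQuadraticSpace BV ε)
    (hU : IsQuadraticSpace BU (-ε)) :
    (toMatrix₂ bV bV BV).map (algebraMap K (coordRing K (surj K V U))) *
      (genMat bV bV (rankLocus BV (Module.finrank K U))).map (rhoComorphism hε hV hU) =
      (genMat bV bU (surj K V U)).transpose * (toMatrix₂ bU bU BU).map (algebraMap K (coordRing K (surj K V U))) *
        genMat bV bU (surj K V U) := by
  refine matrix_coordRing_ext fun s => ?_
  rw [Matrix.map_mul, Matrix.map_mul, Matrix.map_mul, map_algebraMap_map, map_algebraMap_map,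
    Matrix.transpose_map, genMat_map_evalAt, Algebra.algebraMap_self]
  change (toMatrix₂ bV bV BV).map id * _ = _ * (toMatrix₂ bU bU BU).map id * _
  rw [Matrix.map_id, Matrix.map_id, ← toMatrix_rhoMap bV bU hV.nondegenerate]
  congr 1

/-- The function `X ↦ det (X a)` on `L'`. -/
def detMulRight (a : Matrix n m K) : coordRing K (surj K V U) :=
  (genMat bV bU (surj K V U) * a.map (algebraMap K (coordRing K (surj K V U)))).det

theorem algHom_detMulRight {B : Type*} [CommRing B] [Algebra K B]
    (χ : coordRing K (surj K V U) →ₐ[K] B) (a : Matrix n m K) :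
    χ (detMulRight bV bU a) =
      ((genMat bV bU (surj K V U)).map χ * a.map (algebraMap K B)).det := by
  rw [detMulRight, AlgHom.map_det, AlgHom.mapMatrix_apply, Matrix.map_mul, map_algebraMap_map]

/-- Taking for `a` the matrix of a right inverse of `X` makes `X a = 1`; thus the loci `det (X a) ≠
0` cover `L'`. -/
theorem exists_detMulRight_ne_zero (X : surj K V U) :
    ∃ a : Matrix n m K, (detMulRight bV bU a).1 X ≠ 0 := by
  obtain ⟨s, hs⟩ := X.1.exists_rightInverse_of_surjective (LinearMap.range_eq_top.2 X.2)
  refine ⟨LinearMap.toMatrix bU bV s, ?_⟩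
  change evalAt K _ X (detMulRight bV bU _) ≠ 0
  rw [algHom_detMulRight, genMat_map_evalAt, Algebra.algebraMap_self]
  change (LinearMap.toMatrix bV bU X.1 * (LinearMap.toMatrix bU bV s).map id).det ≠ 0
  rw [Matrix.map_id, ← LinearMap.toMatrix_comp, hs, LinearMap.toMatrix_id, Matrix.det_one]
  exact one_ne_zero

theorem mul_eq_zero_of_quotient {B : Type*} [CommRing B] {I : Ideal B} (hI : I ^ 2 = ⊥) (x y : B)
    (hx : Ideal.Quotient.mk I x = 0) (hy : Ideal.Quotient.mk I y = 0) : x * y = 0 := by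
  rw [Ideal.Quotient.eq_zero_iff_mem] at hx hy
  have := Ideal.mul_mem_mul hx hy
  rwa [← pow_two, hI] at this

theorem isUnit_two_of_algebra {B : Type*} [CommRing B] [Algebra K B] (h2 : (2 : K) ≠ 0) :
    IsUnit (2 : B) := by
  have := (isUnit_iff_ne_zero.2 h2).map (algebraMap K B)
  rwa [map_ofNat] at this

open LinearMap in
/-- `π` has the square-zero lifting property at surjective maps. -/
theorem piComorphism_lift (h2 : (2 : K) ≠ 0) (hε : ε = 1 ∨ ε = -1) (hV : IsQuadraticSpace BV ε)
    (hU : IsQuadraticSpace BU (-ε)) (hdim : Module.finrank K U ≤ Module.finrank K V)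
    (a : Matrix n m K) (B : Type u) [CommRing B] [Algebra K B] (I : Ideal B) (hI : I ^ 2 = ⊥)
    (τ : coordRing K (lieAlg BU) →ₐ[K] B) (σ : coordRing K (surj K V U) →ₐ[K] B ⧸ I)
    (hστ : (Ideal.Quotient.mkₐ K I).comp τ = σ.comp (piComorphism hε hV hU))
    (hu : IsUnit (σ (detMulRight bV bU a))) :
    ∃ σ' : coordRing K (surj K V U) →ₐ[K] B,
      (Ideal.Quotient.mkₐ K I).comp σ' = σ ∧ σ'.comp (piComorphism hε hV hU) = τ := by
  have hεε : ε * ε = 1 := by rcases hε with rfl | rfl <;> simp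
  have hε' : -ε = 1 ∨ -ε = -1 := by rcases hε with rfl | rfl <;> simp
  obtain ⟨X, hX⟩ := exists_matrix_map_eq (Ideal.Quotient.mkₐ_surjective K I)
    ((genMat bV bU (surj K V U)).map σ)
  have hdet : IsUnit (X * a.map (algebraMap K B)).det := by
    refine (IsNilpotent.isUnit_quotient_mk_iff ⟨2, hI⟩).1 ?_
    rw [algHom_detMulRight, ← hX, ← map_algebraMap_map (Ideal.Quotient.mkₐ K I) a,
      ← Matrix.map_mul] at hu
    rw [RingHom.map_det]
    exact hu
  have hJ := (Matrix.isUnit_iff_isUnit_det _).1 (isUnit_gram bU hU.nondegenerate)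
  set J := toMatrix₂ bU bU BU with hJdef
  set G := (toMatrix₂ bV bV BV)⁻¹ with hG
  set D := genMat bU bU (lieAlg BU) with hD
  -- The right-hand side of the equation `X G Xᵀ = D J⁻¹` has the symmetry type of `G`. The symmetry
  -- is checked at points of the Lie algebra and then transported by `τ` to `B`.
  have hskew : (D * J⁻¹.map (algebraMap K (coordRing K (lieAlg BU)))).transpose =
      algebraMap K (coordRing K (lieAlg BU)) ε • (D * J⁻¹.map (algebraMap K (coordRing K (lieAlg BU)))) := by
    refine matrix_coordRing_ext fun s => ?_
    have := lieAlg_mul_gram_inv_transpose bU hε' hU s.2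
    rw [neg_neg] at this
    rw [Matrix.transpose_map, matrix_smul_map, Matrix.map_mul, map_algebraMap_map, hD,
      genMat_map_evalAt, Algebra.algebraMap_self, AlgHom.commutes]
    change (toMatrix bU bU s.1 * J⁻¹.map id).transpose = ε • (toMatrix bU bU s.1 * J⁻¹.map id)
    rwa [Matrix.map_id]
  have hE := congrArg (fun M => M.map τ) hskew
  simp only [Matrix.transpose_map, matrix_smul_map, Matrix.map_mul, map_algebraMap_map,
    AlgHom.commutes] at hE
  have hDq : (D.map τ).map (Ideal.Quotient.mkₐ K I) = X.map (Ideal.Quotient.mkₐ K I) *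
      G.map (algebraMap K (B ⧸ I)) * (X.map (Ideal.Quotient.mkₐ K I)).transpose *
        J.map (algebraMap K (B ⧸ I)) := by
    have h1 := congrArg (fun M => M.map σ) (genMat_map_piComorphism bV bU hε hV hU)
    simp only [Matrix.transpose_map, Matrix.map_mul, map_algebraMap_map] at h1
    rw [hX, ← h1]
    ext i j
    exact DFunLike.congr_fun hστ (D i j)
  have hJJ (B : Type u) [CommRing B] [Algebra K B] :
      J.map (algebraMap K B) * J⁻¹.map (algebraMap K B) = 1 := by
    rw [← Matrix.map_mul, Matrix.mul_nonsing_inv _ hJ,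
      Matrix.map_one _ (map_zero _) (map_one _)]
  have hJJ' : J⁻¹.map (algebraMap K B) * J.map (algebraMap K B) = 1 := by
    rw [← Matrix.map_mul, Matrix.nonsing_inv_mul _ hJ,
      Matrix.map_one _ (map_zero _) (map_one _)]
  obtain ⟨Y, hYX, hY⟩ := exists_mul_mul_transpose_eq (q := Ideal.Quotient.mk I)
    (mul_eq_zero_of_quotient hI) (isUnit_two_of_algebra h2)
    (ε := algebraMap K B ε) (by rw [← map_mul, hεε, map_one])
    (G := G.map (algebraMap K B))
    (isUnit_map_algebraMap (Matrix.isUnit_nonsing_inv_iff.2 (isUnit_gram bV hV.nondegenerate)))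
    (by rw [← Matrix.transpose_map, hG, gram_inv_transpose bV hε hV, matrix_smul_map])
    hE X (a.map (algebraMap K B) * (X * a.map (algebraMap K B))⁻¹)
    (by rw [← Matrix.mul_assoc, Matrix.mul_nonsing_inv _ hdet])
    (by
      change Matrix.map _ (Ideal.Quotient.mkₐ K I) = Matrix.map _ (Ideal.Quotient.mkₐ K I)
      rw [Matrix.map_mul, Matrix.map_mul, Matrix.map_mul, hDq, map_algebraMap_map,
        map_algebraMap_map, Matrix.mul_assoc _ (J.map (algebraMap K (B ⧸ I))), hJJ, Matrix.mul_one,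
        Matrix.transpose_map])
  -- By density of `L'` the lifted matrix is a `B`-point of `K[L']` without further conditions.
  obtain ⟨σ', hσ'⟩ := exists_algHom_genMat_surj bV bU hdim Y
  refine ⟨σ', genMat_algHom_ext bV bU ?_, genMat_algHom_ext bU bU ?_⟩
  · rw [← hX]
    refine Eq.trans ?_ hYX
    rw [← hσ']
    rfl
  · have h1 := congrArg (fun M => M.map σ') (genMat_map_piComorphism bV bU hε hV hU)
    simp only [Matrix.transpose_map, Matrix.map_mul, map_algebraMap_map] at h1
    refine Eq.trans h1 ?_
    rw [hσ', hY, Matrix.mul_assoc, hJJ', Matrix.mul_one]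

end Lifting

/-! ### Infinitesimal lifting for `ρ` -/

section RhoLifting

variable {K : Type u} [Field K] [IsAlgClosed K] {V U : Type u} [AddCommGroup V] [Module K V]
  [FiniteDimensional K V] [AddCommGroup U] [Module K U] [FiniteDimensional K U]
  {BV : LinearMap.BilinForm K V} {BU : LinearMap.BilinForm K U} {ε : K}
  {m n : Type} [Fintype m] [Fintype n] [DecidableEq m]
  [DecidableEq n] (bV : Module.Basis n K V) (bU : Module.Basis m K U)

theorem adjugate_map {A B F : Type*} [CommRing A] [CommRing B] [FunLike F A B]
    [RingHomClass F A B] (χ : F) (M : Matrix m m A) : M.adjugate.map χ = (M.map χ).adjugate :=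
  RingHom.map_adjugate (χ : A →+* B) M

theorem det_map {A B F : Type*} [CommRing A] [CommRing B] [FunLike F A B]
    [RingHomClass F A B] (χ : F) (M : Matrix m m A) : χ M.det = (M.map χ).det :=
  RingHom.map_det (χ : A →+* B) M

open LinearMap in
/-- `ρ` has the square-zero lifting property at surjective maps. -/
theorem rhoComorphism_lift (h2 : (2 : K) ≠ 0) (hε : ε = 1 ∨ ε = -1) (hV : IsQuadraticSpace BV ε)
    (hU : IsQuadraticSpace BU (-ε)) (hdim : Module.finrank K U ≤ Module.finrank K V)
    (himage : rhoMap hV.nondegenerate BU '' surj K V U = rankLocus BV (Module.finrank K U))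
    (a : Matrix n m K) (B : Type u) [CommRing B] [Algebra K B] (I : Ideal B) (hI : I ^ 2 = ⊥)
    (τ : coordRing K (rankLocus BV (Module.finrank K U)) →ₐ[K] B)
    (σ : coordRing K (surj K V U) →ₐ[K] B ⧸ I)
    (hστ : (Ideal.Quotient.mkₐ K I).comp τ = σ.comp (rhoComorphism hε hV hU))
    (hu : IsUnit (σ (detMulRight bV bU a))) :
    ∃ σ' : coordRing K (surj K V U) →ₐ[K] B,
      (Ideal.Quotient.mkₐ K I).comp σ' = σ ∧ σ'.comp (rhoComorphism hε hV hU) = τ := by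
  have hεε : -ε * -ε = 1 := by rcases hε with rfl | rfl <;> simp
  obtain ⟨X, hX⟩ := exists_matrix_map_eq (Ideal.Quotient.mkₐ_surjective K I)
    ((genMat bV bU (surj K V U)).map σ)
  have hdet : IsUnit (X * a.map (algebraMap K B)).det := by
    refine (IsNilpotent.isUnit_quotient_mk_iff ⟨2, hI⟩).1 ?_
    rw [algHom_detMulRight, ← hX, ← map_algebraMap_map (Ideal.Quotient.mkₐ K I) a,
      ← Matrix.map_mul] at hu
    rw [RingHom.map_det]
    exact hu
  have hJ := (Matrix.isUnit_iff_isUnit_det _).1 (isUnit_gram bV hV.nondegenerate)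
  set JV := toMatrix₂ bV bV BV with hJV
  set J := toMatrix₂ bU bU BU with hJdef
  set S := JV.map (algebraMap K (coordRing K (rankLocus BV (Module.finrank K U)))) * genMat bV bV (rankLocus BV (Module.finrank K U)) with hS
  have hSpt (s : (rankLocus BV (Module.finrank K U))) : S.map (evalAt K (rankLocus BV (Module.finrank K U)) s) = JV * toMatrix bV bV s.1 := by
    rw [hS, Matrix.map_mul, map_algebraMap_map, genMat_map_evalAt, Algebra.algebraMap_self]
    rfl
  have hskew : S.transpose = algebraMap K (coordRing K (rankLocus BV (Module.finrank K U))) (-ε) • S := by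
    refine matrix_coordRing_ext fun s => ?_
    rw [Matrix.transpose_map, matrix_smul_map, AlgHom.commutes, hSpt]
    exact gram_mul_lieAlg_transpose bV hV s.2.1
  -- The only equations of the rank locus that the lifting needs are the skew symmetry and this one.
  -- Since `K[S]` is a ring of functions, it may be checked pointwise, where `himage` writes `S` as
  -- a Gram matrix `Xᵀ J X`.
  have hrel : S * a.map (algebraMap K (coordRing K (rankLocus BV (Module.finrank K U)))) *
      ((a.map (algebraMap K (coordRing K (rankLocus BV (Module.finrank K U))))).transpose * S *
        a.map (algebraMap K (coordRing K (rankLocus BV (Module.finrank K U))))).adjugate *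
      ((a.map (algebraMap K (coordRing K (rankLocus BV (Module.finrank K U))))).transpose * S) =
      ((a.map (algebraMap K (coordRing K (rankLocus BV (Module.finrank K U))))).transpose * S *
        a.map (algebraMap K (coordRing K (rankLocus BV (Module.finrank K U))))).det • S := by
    refine matrix_coordRing_ext fun s => ?_
    obtain ⟨X, hX, hXs⟩ : (s : Module.End K V) ∈ rhoMap hV.nondegenerate BU '' surj K V U :=
      by rw [himage]; exact s.2
    simp only [matrix_smul_map, Matrix.map_mul, adjugate_map, det_map, map_algebraMap_map, hSpt,
      Matrix.transpose_map, Algebra.algebraMap_self]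
    rw [← hXs, hJV, toMatrix_rhoMap bV bU]
    exact gram_mul_adjugate_mul _ _ a
  have hskew' := congrArg (fun M => M.map τ) hskew
  have hrel' := congrArg (fun M => M.map τ) hrel
  simp only [matrix_smul_map, Matrix.map_mul, adjugate_map, det_map, map_algebraMap_map,
    Matrix.transpose_map, AlgHom.commutes] at hskew' hrel'
  have hStau : S.map τ = JV.map (algebraMap K B) * (genMat bV bV (rankLocus BV (Module.finrank K U))).map τ := by
    rw [hS, Matrix.map_mul, map_algebraMap_map]
  have hSσ' (C : Type u) [CommRing C] [Algebra K C] (χ : coordRing K (surj K V U) →ₐ[K] C) :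
      S.map (χ.comp (rhoComorphism hε hV hU)) = ((genMat bV bU (surj K V U)).map χ).transpose *
        J.map (algebraMap K C) * (genMat bV bU (surj K V U)).map χ := by
    have h1 := congrArg (fun M => M.map χ) (gram_mul_genMat_map_rhoComorphism bV bU hε hV hU)
    simp only [Matrix.transpose_map, Matrix.map_mul, map_algebraMap_map] at h1
    rw [hS, Matrix.map_mul, map_algebraMap_map, ← h1]
    rfl
  obtain ⟨Y, hYX, hY⟩ := exists_transpose_mul_mul_eq (q := Ideal.Quotient.mk I)
    (mul_eq_zero_of_quotient hI) (fun x => (IsNilpotent.isUnit_quotient_mk_iff ⟨2, hI⟩).1)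
    (isUnit_two_of_algebra h2)
    (η := algebraMap K B (-ε)) (by rw [← map_mul, hεε, map_one])
    (J := J.map (algebraMap K B)) (isUnit_map_algebraMap (isUnit_gram bU hU.nondegenerate))
    (by rw [← Matrix.transpose_map, hJdef, gram_transpose bU hU, matrix_smul_map])
    hskew' X (a.map (algebraMap K B)) hdet hrel'
    (by
      change Matrix.map _ (Ideal.Quotient.mkₐ K I) = Matrix.map _ (Ideal.Quotient.mkₐ K I)
      have h1 : (S.map τ).map (Ideal.Quotient.mkₐ K I) =
          S.map (σ.comp (rhoComorphism hε hV hU)) := by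
        rw [← hστ]; rfl
      rw [h1, hSσ', ← hX, Matrix.map_mul, Matrix.map_mul, map_algebraMap_map,
        Matrix.transpose_map])
  obtain ⟨σ', hσ'⟩ := exists_algHom_genMat_surj bV bU hdim Y
  refine ⟨σ', genMat_algHom_ext bV bU ?_, genMat_algHom_ext bV bV ?_⟩
  · rw [← hX]
    refine Eq.trans ?_ hYX
    rw [← hσ']
    rfl
  · have h1 := hSσ' B σ'
    rw [hσ', hY, hStau, hS, Matrix.map_mul, map_algebraMap_map] at h1
    have h2 := congrArg (fun M => JV⁻¹.map (algebraMap K B) * M) h1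
    simpa only [← Matrix.mul_assoc, ← Matrix.map_mul, Matrix.nonsing_inv_mul _ hJ,
      Matrix.map_one _ (map_zero (algebraMap K B)) (map_one (algebraMap K B)), Matrix.one_mul]
      using h2

end RhoLifting

/-! ### From smoothness of algebras to smoothness of varieties -/

section SmoothScheme

variable {K : Type u} [Field K] [IsAlgClosed K] {W W' : Type u} [AddCommGroup W] [Module K W]
  [AddCommGroup W'] [Module K W'] [FiniteDimensional K W] [FiniteDimensional K W']

/-- The open immersion of the variety of `S` into `Spec K[S]`. -/
def variety.ι {S : Set W} (hS : IsZariskiLocallyClosed K S) :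
    variety K hS ⟶ Spec (.of (coordRing K S)) :=
  (varietyOpen K hS).ι

instance {S : Set W} (hS : IsZariskiLocallyClosed K S) : IsOpenImmersion (variety.ι hS) :=
  inferInstanceAs (IsOpenImmersion (varietyOpen K hS).ι)

theorem variety.map_comp_ι {S : Set W} {T : Set W'} (hS : IsZariskiLocallyClosed K S)
    (hT : IsZariskiLocallyClosed K T) (f : W → W') (hf : Set.MapsTo f S T)
    (hpoly : ∀ φ : Module.Dual K W', (fun w => φ (f w)) ∈ polyFun K W) :
    variety.map K hS hT f hf hpoly ≫ variety.ι hT =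
      variety.ι hS ≫ Spec.map (CommRingCat.ofHom (comorphism K f hf hpoly).toRingHom) :=
  Scheme.Hom.resLE_comp_ι _ _

/-- Smoothness is local on the source: the preimages in `X` of the basic opens `D(h)` cover it, and
each is open in a `D(h)` that is smooth over `Spec R`. -/
theorem smooth_of_forall_basicOpen {X : Scheme.{u}} {A R : CommRingCat.{u}} (ι : X ⟶ Spec A)
    [IsOpenImmersion ι] (φ : R ⟶ A)
    (H : ∀ x : X, ∃ h : A, h ∉ (ι x).asIdeal ∧
      ((algebraMap A (Localization.Away h)).comp φ.hom).Smooth) :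
    Smooth (ι ≫ Spec.map φ) := by
  choose h hx hh using H
  let e (x : X) : Spec (.of (Localization.Away (h x))) ⟶ Spec A :=
    Spec.map (CommRingCat.ofHom (algebraMap A (Localization.Away (h x))))
  have he (x : X) : IsOpenImmersion (e x) :=
    inferInstanceAs (IsOpenImmersion (Spec.map (CommRingCat.ofHom
      (algebraMap A (Localization.Away (h x))))))
  have hloc : IsZariskiLocalAtSource (@Smooth.{u} : MorphismProperty Scheme.{u}) :=
    HasRingHomProperty.instIsZariskiLocalAtSource (Q := RingHom.Smooth)
  refine @IsZariskiLocalAtSource.of_iSup_eq_top _ hloc _ _ _ _ (fun x : X => ι ⁻¹ᵁ (e x).opensRange) ?_ fun x => ?_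
  · refine top_le_iff.1 fun x _ => TopologicalSpace.Opens.mem_iSup.2 ⟨x, ?_⟩
    change ι x ∈ Set.range (PrimeSpectrum.comap (algebraMap A (Localization.Away (h x))))
    rw [PrimeSpectrum.localization_away_comap_range _ (h x)]
    exact hx x
  · have hr : Set.range ((ι ⁻¹ᵁ (e x).opensRange).ι ≫ ι) ⊆ Set.range (e x) := by
      rintro _ ⟨y, rfl⟩
      exact y.2
    have hfac := IsOpenImmersion.lift_fac (e x) ((ι ⁻¹ᵁ (e x).opensRange).ι ≫ ι) hr
    have ho : IsOpenImmersion (IsOpenImmersion.lift (e x) _ hr) := by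
      have : IsOpenImmersion (IsOpenImmersion.lift (e x) _ hr ≫ e x) := by
        rw [hfac]; infer_instance
      exact IsOpenImmersion.of_comp _ (e x)
    rw [← Category.assoc, ← hfac, Category.assoc]
    have hs : Smooth (e x ≫ Spec.map φ) := by
      rw [← Spec.map_comp, HasRingHomProperty.Spec_iff (P := @Smooth)]
      exact hh x
    infer_instance

/-- Closed points suffice because every point of the variety generalizes some `s`, so that `h s ≠ 0`
keeps `h` out of its prime. The open immersion of the target into `Spec K[T]` can be cancelled. -/
theorem variety.smooth_map {S : Set W} {T : Set W'} (hS : IsZariskiLocallyClosed K S)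
    (hT : IsZariskiLocallyClosed K T) (f : W → W') (hf : Set.MapsTo f S T)
    (hpoly : ∀ φ : Module.Dual K W', (fun w => φ (f w)) ∈ polyFun K W)
    (H : ∀ s : S, ∃ h : coordRing K S, h.1 s ≠ 0 ∧
      ((algebraMap _ (Localization.Away h)).comp (comorphism K f hf hpoly).toRingHom).Smooth) :
    Smooth (variety.map K hS hT f hf hpoly) := by
  have h1 : Smooth (variety.map K hS hT f hf hpoly ≫ variety.ι hT) := by
    rw [variety.map_comp_ι]
    refine smooth_of_forall_basicOpen _ _ fun x => ?_
    obtain ⟨s, hs⟩ := x.2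
    obtain ⟨h, hne, hh⟩ := H s
    exact ⟨h, fun hx => hne (hs hx), hh⟩
  have hpost : MorphismProperty.HasOfPostcompProperty
      (@Smooth.{u} : MorphismProperty Scheme.{u}) (@IsOpenImmersion.{u}) :=
    @instHasOfPostcompPropertySchemeIsOpenImmersionOfIsStableUnderBaseChange _
      smooth_isStableUnderBaseChange
  exact hpost.of_postcomp _ (variety.ι hT) inferInstance h1

end SmoothScheme

/-! ### The Cayley transform and reducedness of the isometry scheme -/

section Cayley

variable {K : Type u} [Field K] {m : Type} [Fintype m] [DecidableEq m]

theorem transpose_mul_mul_mul {R k l : Type*} [CommRing R] [Fintype k] [Fintype l]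
    (J : Matrix m m R) (g : Matrix m k R) (h : Matrix k l R) :
    (g * h).transpose * J * (g * h) = h.transpose * (g.transpose * J * g) * h := by
  simp only [Matrix.transpose_mul, Matrix.mul_assoc]

/-- For skew-adjoint `D` the cross terms cancel, so `1 - D` and `1 + D` pull `J` back to the same
form. -/
theorem cayley_isometry {R : Type*} [CommRing R] {J D N : Matrix m m R}
    (hD : D.transpose * J = -(J * D)) (hN : (1 + D) * N = 1) :
    ((1 - D) * N).transpose * J * ((1 - D) * N) = J := by
  have h1 : (1 - D).transpose * J * (1 - D) = (1 + D).transpose * J * (1 + D) := by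
    simp only [Matrix.transpose_add, Matrix.transpose_sub, Matrix.transpose_one, Matrix.add_mul,
      Matrix.sub_mul, Matrix.mul_add, Matrix.mul_sub, Matrix.one_mul, Matrix.mul_one, hD]
    abel
  calc ((1 - D) * N).transpose * J * ((1 - D) * N)
      = N.transpose * ((1 - D).transpose * J * (1 - D)) * N := by
        simp only [Matrix.transpose_mul, Matrix.mul_assoc]
    _ = ((1 + D) * N).transpose * J * ((1 + D) * N) := by
        rw [h1]; simp only [Matrix.transpose_mul, Matrix.mul_assoc]
    _ = J := by rw [hN]; simp

/-- With `D = (1 - h)(1 + h)⁻¹`, pulling `DᵀJ + JD` back along `1 + h` gives `(1 - h)ᵀJ(1 + h) + (1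
+ h)ᵀJ(1 - h) = 2(J - hᵀJh) = 0`. -/
theorem cayley_skew {R : Type*} [CommRing R] {J h N : Matrix m m R}
    (hh : h.transpose * J * h = J) (hN : (1 + h) * N = 1) :
    ((1 - h) * N).transpose * J = -(J * ((1 - h) * N)) := by
  have hN' : N * (1 + h) = 1 := mul_eq_one_comm.1 hN
  have hDh : (1 - h) * N * (1 + h) = 1 - h := by rw [Matrix.mul_assoc, hN', Matrix.mul_one]
  generalize (1 - h) * N = D at hDh ⊢
  have h2 : (1 + h).transpose * D.transpose = (1 - h).transpose := by
    rw [← Matrix.transpose_mul, hDh]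
  have key : (1 + h).transpose * (D.transpose * J + J * D) * (1 + h) = 0 := by
    have h3 : (1 + h).transpose * (D.transpose * J + J * D) * (1 + h) =
        (1 + h).transpose * D.transpose * J * (1 + h) +
          (1 + h).transpose * J * (D * (1 + h)) := by
      simp only [Matrix.mul_assoc, Matrix.mul_add, Matrix.add_mul]
      abel
    rw [h3, h2, hDh]
    simp only [Matrix.transpose_add, Matrix.transpose_sub, Matrix.transpose_one, Matrix.add_mul,
      Matrix.sub_mul, Matrix.mul_add, Matrix.mul_sub, Matrix.one_mul, Matrix.mul_one, hh]
    abel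
  rw [eq_neg_iff_add_eq_zero]
  calc D.transpose * J + J * D
      = ((1 + h) * N).transpose * (D.transpose * J + J * D) * ((1 + h) * N) := by
        rw [hN, Matrix.transpose_one, Matrix.one_mul, Matrix.mul_one]
    _ = N.transpose * ((1 + h).transpose * (D.transpose * J + J * D) * (1 + h)) * N := by
        rw [Matrix.transpose_mul]; simp only [Matrix.mul_assoc]
    _ = 0 := by rw [key, Matrix.mul_zero, Matrix.zero_mul]

/-- The Cayley transform is an involution, in a form without a second inverse. The factor `2` shows
that the transform can be applied again when `2` is a unit. -/
theorem cayley_cayley {R : Type*} [CommRing R] {h N : Matrix m m R} (hN : (1 + h) * N = 1) :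
    h * (1 + (1 - h) * N) = 1 - (1 - h) * N ∧ (1 + (1 - h) * N) * (1 + h) = 2 := by
  have hN' : N * (1 + h) = 1 := mul_eq_one_comm.1 hN
  have hc : h * N = N * h := by
    have := hN.trans hN'.symm
    rw [add_mul, mul_add, one_mul, mul_one] at this
    exact add_left_cancel this
  have h1 : N = 1 - h * N := by rw [← hN]; noncomm_ring
  constructor
  · have : h * (1 + (1 - h) * N) = h * ((1 + h) * N + (1 - h) * N) := by rw [hN]
    rw [this]
    have h2 : 1 - (1 - h) * N = (1 + h) * N - (1 - h) * N := by rw [hN]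
    rw [h2]
    noncomm_ring
  · rw [add_mul, mul_assoc, hN', one_mul, mul_one, add_add_sub_cancel, one_add_one_eq_two]

/-- The skew-adjoint part of a matrix. -/
def skewPart {R : Type*} [CommRing R] (J J' : Matrix m m R) (c : R) (Z : Matrix m m R) :
    Matrix m m R :=
  c • (Z - J' * Z.transpose * J)

/-- `J' Zᵀ J` is the adjoint of `Z`, and the symmetry of `J` makes adjunction an involution.
Together with the next lemma this parametrizes the skew-adjoint matrices by all matrices, so that
the generic one has entries in a polynomial ring. -/
theorem skewPart_skew {R : Type*} [CommRing R] {J J' : Matrix m m R} (c : R) (Z : Matrix m m R)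
    {η : R} (hη : η * η = 1) (hJT : J.transpose = η • J) (hJT' : J'.transpose = η • J')
    (hJ : J * J' = 1) :
    (skewPart J J' c Z).transpose * J = -(J * skewPart J J' c Z) := by
  have hJ' : J' * J = 1 := mul_eq_one_comm.1 hJ
  simp only [skewPart, Matrix.transpose_smul, Matrix.transpose_sub, Matrix.transpose_mul, hJT, hJT',
    Matrix.transpose_transpose, Matrix.smul_mul, Matrix.mul_smul, Matrix.mul_sub, Matrix.sub_mul,
    smul_smul, hη, one_smul]
  have h1 : J * (Z * J') * J = J * Z := by
    rw [Matrix.mul_assoc, Matrix.mul_assoc, hJ', Matrix.mul_one]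
  have h2 : J * (J' * Z.transpose * J) = Z.transpose * J := by
    rw [← Matrix.mul_assoc, ← Matrix.mul_assoc, hJ, Matrix.one_mul]
  rw [h1, h2, ← smul_neg, neg_sub]

theorem skewPart_eq_self {R : Type*} [CommRing R] {J J' : Matrix m m R} {c : R}
    {Z : Matrix m m R} (hc : c * 2 = 1) (hJ : J' * J = 1) (hZ : Z.transpose * J = -(J * Z)) :
    skewPart J J' c Z = Z := by
  rw [skewPart, Matrix.mul_assoc, hZ, Matrix.mul_neg, ← Matrix.mul_assoc, hJ, Matrix.one_mul,
    sub_neg_eq_add, ← two_smul R Z, smul_smul, hc, one_smul]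

theorem skewPart_map {R R' F : Type*} [CommRing R] [CommRing R'] [FunLike F R R']
    [RingHomClass F R R'] (f : F) (J J' : Matrix m m R) (c : R) (Z : Matrix m m R) :
    (skewPart J J' c Z).map f = skewPart (J.map f) (J'.map f) (f c) (Z.map f) := by
  simp only [skewPart, matrix_smul_map, Matrix.map_sub _ (map_sub f), Matrix.map_mul,
    Matrix.transpose_map]

/-- The skew-adjoint part of a matrix over a `K`-algebra. -/
def skewOf (J : Matrix m m K) {R : Type*} [CommRing R] [Algebra K R] (Y : Matrix m m R) :
    Matrix m m R :=
  skewPart (J.map (algebraMap K R)) (J⁻¹.map (algebraMap K R)) (algebraMap K R 2⁻¹) Y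

theorem skewOf_map (J : Matrix m m K) {R R' : Type*} [CommRing R] [Algebra K R] [CommRing R']
    [Algebra K R'] (f : R →ₐ[K] R') (Y : Matrix m m R) :
    (skewOf J Y).map f = skewOf J (Y.map f) := by
  rw [skewOf, skewPart_map, map_algebraMap_map, map_algebraMap_map, AlgHom.commutes, skewOf]

theorem matrix_map_one {A B F : Type*} [CommRing A] [CommRing B] [FunLike F A B]
    [RingHomClass F A B] (f : F) : (1 : Matrix m m A).map f = 1 :=
  Matrix.map_one _ (map_zero f) (map_one f)

/-- The homomorphisms out of the ring of polynomials with `δ` inverted. -/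
theorem exists_algHom_localizationAway {ι R : Type*} [CommRing R] [Algebra K R]
    (δ : MvPolynomial ι K) (z : ι → R) (hz : IsUnit (MvPolynomial.aeval z δ)) :
    ∃ f : Localization.Away δ →ₐ[K] R,
      ∀ p, f (algebraMap (MvPolynomial ι K) _ p) = MvPolynomial.aeval z p := by
  have h : ∀ y : Submonoid.powers δ, IsUnit (MvPolynomial.aeval z (y : MvPolynomial ι K)) := by
    rintro ⟨_, k, rfl⟩
    rw [map_pow]
    exact hz.pow k
  exact ⟨IsLocalization.liftAlgHom (M := Submonoid.powers δ) h,
    fun p => IsLocalization.lift_eq (M := Submonoid.powers δ) h p⟩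

theorem aeval_entries_map {R R' : Type*} [CommRing R] [Algebra K R] [CommRing R'] [Algebra K R']
    (f : R →ₐ[K] R') (g : Matrix m m R) (P : MvPolynomial (m × m) K) :
    f (MvPolynomial.aeval (fun ij => g ij.1 ij.2) P) =
      MvPolynomial.aeval (fun ij => (g.map f) ij.1 ij.2) P := by
  rw [← AlgHom.comp_apply, MvPolynomial.comp_aeval]
  rfl

theorem mvPolynomialX_map_aeval {R : Type*} [CommRing R] [Algebra K R] (Y : Matrix m m R) :
    (Matrix.mvPolynomialX m m K).map (MvPolynomial.aeval fun ij => Y ij.1 ij.2) = Y := by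
  ext i j
  simp [Matrix.mvPolynomialX]

/-- The denominator of the Cayley transform of the generic skew-adjoint matrix. -/
def cayleyDet (J : Matrix m m K) : MvPolynomial (m × m) K :=
  (1 + skewOf J (Matrix.mvPolynomialX m m K)).det

theorem aeval_cayleyDet (J : Matrix m m K) {R : Type*} [CommRing R] [Algebra K R]
    (Y : Matrix m m R) :
    MvPolynomial.aeval (fun ij => Y ij.1 ij.2) (cayleyDet J) = (1 + skewOf J Y).det := by
  rw [cayleyDet, det_map, Matrix.map_add _ (map_add _), matrix_map_one, skewOf_map,
    mvPolynomialX_map_aeval]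

theorem eval_eq_aeval {ι : Type*} (x : ι → K) (P : MvPolynomial ι K) :
    MvPolynomial.eval x P = MvPolynomial.aeval x P :=
  DFunLike.congr_fun (MvPolynomial.coe_aeval_eq_eval x).symm P

/-- A polynomial that vanishes on all isometries vanishes at every isometry `g₀ h` over a
`K`-algebra for which `1 + h` is invertible. -/
theorem aeval_eq_zero_of_isometry [IsAlgClosed K] (h2 : (2 : K) ≠ 0) {η : K} (hη : η * η = 1)
    {J : Matrix m m K} (hJ : IsUnit J.det) (hJT : J.transpose = η • J)
    (hJT' : (J⁻¹).transpose = η • J⁻¹)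
    {P : MvPolynomial (m × m) K}
    (hP : ∀ g : Matrix m m K, g.transpose * J * g = J →
      MvPolynomial.eval (fun ij => g ij.1 ij.2) P = 0)
    {g₀ : Matrix m m K} (hg₀ : g₀.transpose * J * g₀ = J)
    {C : Type u} [CommRing C] [Algebra K C] {h N : Matrix m m C}
    (hh : h.transpose * J.map (algebraMap K C) * h = J.map (algebraMap K C))
    (hN : (1 + h) * N = 1) :
    MvPolynomial.aeval (fun ij => (g₀.map (algebraMap K C) * h) ij.1 ij.2) P = 0 := by
  have hJJ (R : Type u) [CommRing R] [Algebra K R] :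
      J.map (algebraMap K R) * J⁻¹.map (algebraMap K R) = 1 := by
    rw [← Matrix.map_mul, Matrix.mul_nonsing_inv _ hJ, matrix_map_one]
  have hskew (R : Type u) [CommRing R] [Algebra K R] (Y : Matrix m m R) :
      (skewOf J Y).transpose * J.map (algebraMap K R) = -(J.map (algebraMap K R) * skewOf J Y) :=
    skewPart_skew _ _ (η := algebraMap K R η) (by rw [← map_mul, hη, map_one])
      (by rw [← Matrix.transpose_map, hJT, matrix_smul_map])
      (by rw [← Matrix.transpose_map, hJT', matrix_smul_map]) (hJJ R)
  let E := Localization.Away (cayleyDet J)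
  set D : Matrix m m E := skewOf J ((Matrix.mvPolynomialX m m K).map (algebraMap _ E)) with hD
  have hdetD : (1 + D).det = algebraMap _ E (cayleyDet J) := by
    change _ = algebraMap (MvPolynomial (m × m) K) E (1 + skewOf J (Matrix.mvPolynomialX m m K)).det
    rw [det_map, Matrix.map_add _ (map_add _), matrix_map_one]
    congr 2
    exact (skewOf_map J (IsScalarTower.toAlgHom K (MvPolynomial (m × m) K) E) _).symm
  have hu : IsUnit (1 + D).det := by
    rw [hdetD]; exact IsLocalization.Away.algebraMap_isUnit _
  have hDN : (1 + D) * (1 + D)⁻¹ = 1 := Matrix.mul_nonsing_inv _ hu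
  set M := (1 + D)⁻¹ with hM
  have hDf {R : Type u} [CommRing R] [Algebra K R] (Y : Matrix m m R) (f : E →ₐ[K] R)
      (hf : ∀ p, f (algebraMap (MvPolynomial (m × m) K) _ p) =
        MvPolynomial.aeval (fun ij => Y ij.1 ij.2) p) : D.map f = skewOf J Y := by
    rw [hD, skewOf_map]
    congr 1
    conv_rhs => rw [← mvPolynomialX_map_aeval (K := K) Y]
    ext i j
    exact hf _
  have hMf {R : Type u} [CommRing R] [Algebra K R] (Y : Matrix m m R) (f : E →ₐ[K] R)
      (hf : ∀ p, f (algebraMap (MvPolynomial (m × m) K) _ p) =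
        MvPolynomial.aeval (fun ij => Y ij.1 ij.2) p) : (1 + skewOf J Y) * M.map f = 1 := by
    rw [← hDf Y f hf, ← matrix_map_one f, ← Matrix.map_add _ (map_add f), ← Matrix.map_mul, hDN]
  -- `q` is the value of `P` at `g₀` times the generic Cayley isometry.
  set q : E := MvPolynomial.aeval
    (fun ij => (g₀.map (algebraMap K E) * ((1 - D) * M)) ij.1 ij.2) P with hq
  have hqf {R : Type u} [CommRing R] [Algebra K R] (Y : Matrix m m R) (f : E →ₐ[K] R)
      (hf : ∀ p, f (algebraMap (MvPolynomial (m × m) K) _ p) =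
        MvPolynomial.aeval (fun ij => Y ij.1 ij.2) p) :
      f q = MvPolynomial.aeval (fun ij =>
        (g₀.map (algebraMap K R) * ((1 - skewOf J Y) * M.map f)) ij.1 ij.2) P := by
    rw [hq, aeval_entries_map, Matrix.map_mul, Matrix.map_mul, map_algebraMap_map,
      Matrix.map_sub _ (map_sub f), matrix_map_one, hDf Y f hf]
  have hq0 : q = 0 := by
    obtain ⟨k, p, hp⟩ := IsLocalization.Away.surj (cayleyDet J) q
    have hp0 : p = 0 := by
      -- The denominator is `1` at the zero matrix. Wherever it does not vanish, the specialization
      -- is an isometry over `K`, at which `P` vanishes by assumption.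
      refine eq_zero_of_eval_eq_zero_of_ne_zero p (cayleyDet J) ⟨fun _ => 0, ?_⟩ fun z hz => ?_
      · rw [eval_eq_aeval]
        have := aeval_cayleyDet J (0 : Matrix m m K)
        simp only [Matrix.zero_apply] at this
        rw [this]
        simp [skewOf, skewPart]
      · set Y : Matrix m m K := Matrix.of fun i j => z (i, j) with hY
        have hz' : z = fun ij => Y ij.1 ij.2 := rfl
        rw [eval_eq_aeval, hz'] at hz ⊢
        obtain ⟨f, hf⟩ := exists_algHom_localizationAway _ _ (isUnit_iff_ne_zero.2 hz)
        have h1 : f q = 0 := by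
          have h3 := hskew K Y
          rw [hqf Y f hf]
          simp only [Algebra.algebraMap_self, RingHom.coe_id, Matrix.map_id] at h3 ⊢
          rw [← eval_eq_aeval]
          refine hP _ ?_
          rw [transpose_mul_mul_mul, hg₀]
          exact cayley_isometry h3 (hMf Y f hf)
        rw [← hf, ← hp, map_mul, h1, zero_mul]
    rw [hp0, map_zero] at hp
    exact ((IsLocalization.Away.algebraMap_isUnit (cayleyDet J)).pow k).mul_left_eq_zero.1 hp
  have hskewh := cayley_skew hh hN
  obtain ⟨hc1, hc2⟩ := cayley_cayley hN
  set Y : Matrix m m C := (1 - h) * N with hY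
  have hYY : skewOf J Y = Y :=
    skewPart_eq_self (by
        rw [← map_ofNat (algebraMap K C) 2, ← map_mul, inv_mul_cancel₀ h2, map_one])
      (mul_eq_one_comm.1 (hJJ C)) hskewh
  have hdetY : IsUnit (1 + Y).det := by
    have h3 := congrArg Matrix.det hc2
    rw [Matrix.det_mul] at h3
    refine isUnit_of_mul_isUnit_left (y := (1 + h).det) ?_
    rw [h3]
    have : (2 : Matrix m m C) = (2 : C) • 1 := by rw [ofNat_smul_eq_nsmul]; simp
    rw [this, Matrix.det_smul, Matrix.det_one, mul_one]
    exact (isUnit_two_of_algebra h2).pow _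
  -- Specializing the generic Cayley isometry at the Cayley transform `Y` of `h` returns `h`.
  obtain ⟨f, hf⟩ := exists_algHom_localizationAway (cayleyDet J) (fun ij => Y ij.1 ij.2)
    (by rwa [aeval_cayleyDet, hYY])
  have h3 := hqf Y f hf
  have h4 := hMf Y f hf
  rw [hYY] at h3 h4
  rw [hq0, map_zero] at h3
  rw [h3]
  have h5 : (1 - Y) * M.map f = h := by
    rw [← hc1, Matrix.mul_assoc, h4, Matrix.mul_one]
  rw [h5]

/-- Nullstellensatz: the residue field is finite over `K`, hence equal to `K`. -/
theorem exists_algHom_ker_eq_of_isMaximal {K A : Type*} [Field K] [IsAlgClosed K] [CommRing A]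
    [Algebra K A] [Algebra.FiniteType K A] (M : Ideal A) [hM : M.IsMaximal] :
    ∃ χ : A →ₐ[K] K, RingHom.ker χ = M := by
  let _ : Field (A ⧸ M) := Ideal.Quotient.field M
  have : Module.Finite K (A ⧸ M) := finite_of_finite_type_of_isJacobsonRing K _
  have hb : Function.Bijective (Algebra.ofId K (A ⧸ M)) :=
    IsAlgClosed.algebraMap_bijective_of_isIntegral
  refine ⟨(AlgEquiv.ofBijective _ hb).symm.toAlgHom.comp (Ideal.Quotient.mkₐ K M), ?_⟩
  ext x
  simp [RingHom.mem_ker, Ideal.Quotient.eq_zero_iff_mem]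

/-- The scheme of isometries is reduced: a polynomial that vanishes on all isometries over `K`
vanishes on all isometries over a `K`-algebra of finite type. -/
theorem aeval_eq_zero_of_isometry_of_finiteType [IsAlgClosed K] (h2 : (2 : K) ≠ 0) {η : K}
    (hη : η * η = 1) {J : Matrix m m K} (hJ : IsUnit J.det) (hJT : J.transpose = η • J)
    (hJT' : (J⁻¹).transpose = η • J⁻¹) {P : MvPolynomial (m × m) K}
    (hP : ∀ g : Matrix m m K, g.transpose * J * g = J →
      MvPolynomial.eval (fun ij => g ij.1 ij.2) P = 0)
    {A : Type u} [CommRing A] [Algebra K A] [Algebra.FiniteType K A] {g : Matrix m m A}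
    (hg : g.transpose * J.map (algebraMap K A) * g = J.map (algebraMap K A)) :
    MvPolynomial.aeval (fun ij => g ij.1 ij.2) P = 0 := by
  set x := MvPolynomial.aeval (fun ij => g ij.1 ij.2) P with hx
  by_contra hne
  have htop : (Submodule.span A {x}).annihilator ≠ ⊤ := by
    rw [Ne, Submodule.annihilator_eq_top_iff, Submodule.span_singleton_eq_bot]
    exact hne
  -- If `x ≠ 0`, its annihilator lies in a maximal ideal `M`. The contradiction will be an element
  -- outside `M` a power of which kills `x`.
  obtain ⟨M, hM, hxM⟩ := Ideal.exists_le_maximal _ htop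
  obtain ⟨χ, hχ⟩ := exists_algHom_ker_eq_of_isMaximal (K := K) M
  set g₀ : Matrix m m K := g.map χ with hg₀
  have hg₀J : g₀.transpose * J * g₀ = J := by
    have h1 := congrArg (fun M => M.map χ) hg
    simp only [Matrix.map_mul, Matrix.transpose_map, map_algebraMap_map, Algebra.algebraMap_self,
      RingHom.coe_id, Matrix.map_id] at h1
    exact h1
  have hdet : IsUnit g₀.det := by
    have h1 := congrArg Matrix.det hg₀J
    rw [Matrix.det_mul] at h1
    exact isUnit_of_mul_isUnit_right (x := (g₀.transpose * J).det) (h1 ▸ hJ)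
  have hgi : g₀ * g₀⁻¹ = 1 := Matrix.mul_nonsing_inv _ hdet
  have hgi' : g₀⁻¹ * g₀ = 1 := Matrix.nonsing_inv_mul _ hdet
  -- Translation by the residue `g₀` of `g` at `M` is needed because `1 + g` itself may be singular,
  -- as for every `g` of determinant `-1`. Now `h` is `1` modulo `M`, so `det (1 + h)` is a power of
  -- `2` there and the Cayley transform exists near `M`.
  set h := g₀⁻¹.map (algebraMap K A) * g with hh
  have hhJ : h.transpose * J.map (algebraMap K A) * h = J.map (algebraMap K A) := by
    have h1 : (g₀⁻¹).transpose * J * g₀⁻¹ = J := by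
      conv_lhs => rw [← hg₀J]
      rw [← transpose_mul_mul_mul, hgi]
      simp
    rw [hh, transpose_mul_mul_mul, ← Matrix.transpose_map, ← Matrix.map_mul, ← Matrix.map_mul, h1,
      hg]
  set d := (1 + h).det with hd
  have hdM : d ∉ M := by
    rw [← hχ, RingHom.mem_ker]
    change χ d ≠ 0
    rw [hd, det_map, Matrix.map_add _ (map_add χ), matrix_map_one, hh, Matrix.map_mul,
      map_algebraMap_map, Algebra.algebraMap_self, RingHom.coe_id, Matrix.map_id, ← hg₀, hgi',
      show (1 + 1 : Matrix m m K) = (2 : K) • 1 by rw [two_smul], Matrix.det_smul, Matrix.det_one,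
      mul_one]
    exact pow_ne_zero _ h2
  let C := Localization.Away d
  let ψ : A →ₐ[K] C := IsScalarTower.toAlgHom K A C
  have hN : (1 + h.map ψ) * (1 + h.map ψ)⁻¹ = 1 := by
    refine Matrix.mul_nonsing_inv _ ?_
    rw [← matrix_map_one ψ, ← Matrix.map_add _ (map_add ψ), ← det_map]
    exact IsLocalization.Away.algebraMap_isUnit d
  have hhψ : (h.map ψ).transpose * J.map (algebraMap K C) * h.map ψ = J.map (algebraMap K C) := by
    have h1 := congrArg (fun M => M.map ψ) hhJ
    simp only [Matrix.map_mul, Matrix.transpose_map, map_algebraMap_map] at h1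
    exact h1
  have h0 := aeval_eq_zero_of_isometry h2 hη hJ hJT hJT' hP hg₀J hhψ hN
  rw [show g₀.map (algebraMap K C) * h.map ψ = g.map ψ by
    rw [hh, Matrix.map_mul, map_algebraMap_map, ← Matrix.mul_assoc, ← Matrix.map_mul, hgi,
      matrix_map_one, Matrix.one_mul], ← aeval_entries_map, ← hx] at h0
  obtain ⟨⟨_, k, rfl⟩, hk⟩ := (IsLocalization.map_eq_zero_iff (Submonoid.powers d) C x).1 h0
  have : d ^ k ∈ M := hxM (by
    rw [Submodule.mem_annihilator_span_singleton]
    exact hk)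
  exact hdM (hM.isPrime.mem_of_pow_mem k this)

/-- The scheme of isometries is reduced. -/
theorem aeval_eq_zero_of_isometry_of_algebra [IsAlgClosed K] (h2 : (2 : K) ≠ 0) {η : K}
    (hη : η * η = 1) {J : Matrix m m K} (hJ : IsUnit J.det) (hJT : J.transpose = η • J)
    (hJT' : (J⁻¹).transpose = η • J⁻¹) {P : MvPolynomial (m × m) K}
    (hP : ∀ g : Matrix m m K, g.transpose * J * g = J →
      MvPolynomial.eval (fun ij => g ij.1 ij.2) P = 0)
    {B : Type*} [CommRing B] [Algebra K B] {g : Matrix m m B}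
    (hg : g.transpose * J.map (algebraMap K B) * g = J.map (algebraMap K B)) :
    MvPolynomial.aeval (fun ij => g ij.1 ij.2) P = 0 := by
  let X := Matrix.mvPolynomialX m m K
  let rel : Matrix m m (MvPolynomial (m × m) K) :=
    X.transpose * J.map (algebraMap K _) * X - J.map (algebraMap K _)
  -- Every isometry over an algebra is a specialization of the universal one over `A`, which is of
  -- finite type.
  let I : Ideal (MvPolynomial (m × m) K) := Ideal.span (Set.range fun ij : m × m => rel ij.1 ij.2)
  let A := MvPolynomial (m × m) K ⧸ I
  let f : A →ₐ[K] B := Ideal.Quotient.liftₐ I (MvPolynomial.aeval fun ij => g ij.1 ij.2) (by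
    intro a ha
    have hle : I ≤ RingHom.ker (MvPolynomial.aeval (R := K) fun ij => g ij.1 ij.2) := by
      rw [Ideal.span_le]
      rintro _ ⟨⟨i, j⟩, rfl⟩
      rw [SetLike.mem_coe, RingHom.mem_ker]
      have h1 : rel.map (MvPolynomial.aeval (R := K) fun ij => g ij.1 ij.2) = 0 := by
        rw [Matrix.map_sub _ (map_sub _), Matrix.map_mul, Matrix.map_mul, Matrix.transpose_map,
          mvPolynomialX_map_aeval, map_algebraMap_map, hg, sub_self]
      exact congrFun (congrFun h1 i) j
    exact hle ha)
  have hA : (X.map (Ideal.Quotient.mkₐ K I)).transpose * J.map (algebraMap K A) *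
      X.map (Ideal.Quotient.mkₐ K I) = J.map (algebraMap K A) := by
    have h1 : rel.map (Ideal.Quotient.mkₐ K I) = 0 := by
      ext i j
      exact Ideal.Quotient.eq_zero_iff_mem.2 (Ideal.subset_span ⟨(i, j), rfl⟩)
    rw [Matrix.map_sub _ (map_sub _), Matrix.map_mul, Matrix.map_mul, Matrix.transpose_map,
      map_algebraMap_map, sub_eq_zero] at h1
    exact h1
  have h0 := congrArg f (aeval_eq_zero_of_isometry_of_finiteType h2 hη hJ hJT hJT' hP hA)
  rw [map_zero, aeval_entries_map] at h0
  rw [← h0]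
  congr
  funext ij
  exact (MvPolynomial.aeval_X (R := K) (fun ij : m × m => g ij.1 ij.2) ij).symm

end Cayley

/-! ### Points of the coordinate ring of `G(U)` -/

section Isometries

variable {K : Type u} [Field K] {U : Type u} [AddCommGroup U] [Module K U] [FiniteDimensional K U]
  {BU : LinearMap.BilinForm K U} {η : K}
  {m : Type} [Fintype m] [DecidableEq m] (bU : Module.Basis m K U)

open LinearMap in
theorem mem_isometries_iff (g : Module.End K U) : g ∈ isometries BU ↔
    (toMatrix bU bU g).transpose * toMatrix₂ bU bU BU * toMatrix bU bU g = toMatrix₂ bU bU BU := by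
  rw [← toMatrix₂_compl₁₂, (toMatrix₂ bU bU).injective.eq_iff]
  constructor
  · intro h
    ext x y
    exact h x y
  · intro h x y
    exact LinearMap.congr_fun (LinearMap.congr_fun h x) y

open LinearMap in
/-- The points of the coordinate ring of `G(U)` are the isometries. -/
theorem exists_algHom_genMat_isometries [IsAlgClosed K] (h2 : (2 : K) ≠ 0) (hη : η = 1 ∨ η = -1)
    (hU : IsQuadraticSpace BU η) {B : Type*} [CommRing B] [Algebra K B] (g : Matrix m m B)
    (hg : g.transpose * (toMatrix₂ bU bU BU).map (algebraMap K B) * g =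
      (toMatrix₂ bU bU BU).map (algebraMap K B)) :
    ∃ χ : coordRing K (isometries BU) →ₐ[K] B, (genMat bU bU (isometries BU)).map χ = g := by
  refine exists_algHom_genMat bU bU _ g fun P hP => ?_
  refine aeval_eq_zero_of_isometry_of_algebra h2 (η := η)
    (by rcases hη with rfl | rfl <;> simp)
    ((Matrix.isUnit_iff_isUnit_det _).1 (isUnit_gram bU hU.nondegenerate))
    (gram_transpose bU hU) (gram_inv_transpose bU hη hU) (fun h hh => ?_) hg
  have := hP (Matrix.toLin bU bU h) ((mem_isometries_iff bU _).2 (by rwa [toMatrix_toLin]))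
  rwa [toMatrix_toLin] at this

end Isometries

/-! ### Pullback squares and fibers over rational points -/

section Pullback

theorem isPullback_of_comp_mono_fst {C : Type*} [Category C] {P X X' Y Z : C} {a : P ⟶ X}
    {b : P ⟶ Y} {i : X ⟶ X'} {f : X' ⟶ Z} {g : Y ⟶ Z} [Mono i]
    (h : IsPullback (a ≫ i) b f g) : IsPullback a b (i ≫ f) g := by
  refine ⟨⟨by rw [← h.w, Category.assoc]⟩, ⟨Limits.PullbackCone.IsLimit.mk _
    (fun s => h.lift (s.fst ≫ i) s.snd (by rw [Category.assoc, s.condition])) (fun s => ?_)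
    (fun s => h.lift_snd _ _ _) fun s l h1 h2 => h.hom_ext ?_ ?_⟩⟩
  · rw [← cancel_mono i, Category.assoc, h.lift_fst]
  · rw [h.lift_fst, ← Category.assoc, h1]
  · rw [h.lift_snd, h2]

theorem isPullback_of_comp_mono {C : Type*} [Category C] {P X Y Z Z' : C} {a : P ⟶ X}
    {b : P ⟶ Y} {f : X ⟶ Z} {g : Y ⟶ Z} {i : Z ⟶ Z'} [Mono i]
    (h : IsPullback a b (f ≫ i) (g ≫ i)) : IsPullback a b f g := by
  have hw : a ≫ f = b ≫ g := by
    rw [← cancel_mono i, Category.assoc, Category.assoc, h.w]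
  refine ⟨⟨hw⟩, ⟨Limits.PullbackCone.IsLimit.mk _
    (fun s => h.lift s.fst s.snd (by
      rw [← Category.assoc, s.condition, Category.assoc])) (fun s => h.lift_fst _ _ _)
    (fun s => h.lift_snd _ _ _) fun s l h1 h2 => h.hom_ext ?_ ?_⟩⟩
  · rw [h.lift_fst, h1]
  · rw [h.lift_snd, h2]

/-- The scheme-theoretic fiber over a rational point. -/
theorem exists_fiber_iso_of_isPullback {X Y F : Scheme.{u}} (f : X ⟶ Y) {K : Type u} [Field K]
    {y : Y} {pt : Spec (.of K) ⟶ Y} (hy : pt (IsLocalRing.closedPoint K) = y)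
    {s : Y ⟶ Spec (.of K)} (hs : pt ≫ s = 𝟙 _) {i : F ⟶ X} {b : F ⟶ Spec (.of K)}
    (h : IsPullback i b f pt) : ∃ e : f.fiber y ≅ F, e.hom ≫ i = f.fiberι y := by
  subst hy
  set d := Y.descResidueField (Scheme.stalkClosedPointTo pt) with hd
  have hfac : Spec.map d ≫ Y.fromSpecResidueField _ = pt :=
    Scheme.descResidueField_stalkClosedPointTo_fromSpecResidueField K Y pt
  have hsplit : Spec.map d ≫ (Y.fromSpecResidueField _ ≫ s) = 𝟙 _ := by
    rw [← Category.assoc, hfac, hs]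
  have hd' : Spec.preimage (Y.fromSpecResidueField _ ≫ s) ≫ d = 𝟙 _ := by
    apply Spec.map_injective
    rw [Spec.map_comp, Spec.map_preimage, hsplit, Spec.map_id]
  -- The residue field at a `K`-rational point is `K`: `d` is injective as a map of fields, and the
  -- structure morphism `s` gives it a right inverse.
  have hiso : IsIso d := by
    refine (ConcreteCategory.isIso_iff_bijective d).2 ⟨RingHom.injective d.hom, fun x =>
      ⟨(Spec.preimage (Y.fromSpecResidueField _ ≫ s)).hom x, ?_⟩⟩
    exact congrArg (fun t : CommRingCat.of K ⟶ CommRingCat.of K => t.hom x) hd'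
  have h' : IsPullback i (b ≫ Spec.map d) f (Y.fromSpecResidueField _) :=
    h.of_iso (Iso.refl _) (Iso.refl _) (asIso (Spec.map d)) (Iso.refl _) (by simp) (by simp)
      (by simp) (by simp [hfac])
  exact ⟨h'.isoPullback.symm, h'.isoPullback_inv_fst⟩

end Pullback

/-! ### Points of a variety as morphisms from `Spec K` -/

section RationalPoint

variable {K : Type u} [Field K] [IsAlgClosed K] {W : Type u} [AddCommGroup W] [Module K W]
  [FiniteDimensional K W] {S : Set W} (hS : IsZariskiLocallyClosed K S)

theorem specMap_evalAt_mem (s : S) (x : Spec (.of K)) :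
    (Spec.map (CommRingCat.ofHom (evalAt K S s).toRingHom)) x = specPt K S s := by
  have hx : x.asIdeal = ⊥ := Ideal.eq_bot_of_prime (h := x.2)
  apply PrimeSpectrum.ext
  ext a
  change evalAt K S s a ∈ x.asIdeal ↔ _
  rw [hx, Ideal.mem_bot]
  rfl

/-- The morphism `Spec K ⟶ S` with image the point `s`. -/
def variety.ptHom (s : S) : Spec (.of K) ⟶ variety K hS :=
  IsOpenImmersion.lift (variety.ι hS) (Spec.map (CommRingCat.ofHom (evalAt K S s).toRingHom)) (by
    rintro _ ⟨x, rfl⟩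
    rw [specMap_evalAt_mem]
    exact ⟨variety.pt K hS s, rfl⟩)

theorem variety.ptHom_comp_ι (s : S) : variety.ptHom hS s ≫ variety.ι hS =
    Spec.map (CommRingCat.ofHom (evalAt K S s).toRingHom) :=
  IsOpenImmersion.lift_fac _ _ _

theorem variety.ptHom_apply (s : S) (x : Spec (.of K)) :
    variety.ptHom hS s x = variety.pt K hS s := by
  apply (variety.ι hS).isOpenEmbedding.injective
  rw [← Scheme.Hom.comp_apply, variety.ptHom_comp_ι, specMap_evalAt_mem]
  rfl

theorem variety.toSpec_eq : variety.toSpec K hS =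
    variety.ι hS ≫ Spec.map (CommRingCat.ofHom (algebraMap K (coordRing K S))) := rfl

theorem variety.ptHom_comp_toSpec (s : S) : variety.ptHom hS s ≫ variety.toSpec K hS = 𝟙 _ := by
  rw [variety.toSpec_eq, ← Category.assoc, variety.ptHom_comp_ι, ← Spec.map_comp, ← Spec.map_id]
  rfl

end RationalPoint

/-! ### Fibers of `ρ` as orbits of `G(U)` -/

section Orbit

variable {K : Type u} [Field K] {V U : Type u} [AddCommGroup V] [Module K V]
  [FiniteDimensional K V] [AddCommGroup U] [Module K U] [FiniteDimensional K U]
  {BV : LinearMap.BilinForm K V} {BU : LinearMap.BilinForm K U} {ε : K}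

theorem injective_of_mem_isometries (hU : BU.Nondegenerate) {g : Module.End K U}
    (hg : g ∈ isometries BU) : Function.Injective g := by
  rw [injective_iff_map_eq_zero]
  intro x hx
  refine hU.1 x fun y => ?_
  rw [← hg x y, hx, map_zero, LinearMap.zero_apply]

theorem orbit_mapsTo (hU : BU.Nondegenerate) (X : surj K V U) :
    Set.MapsTo (LinearMap.lcomp K U X.1) (isometries BU) (surj K V U) := fun _ hg =>
  (LinearMap.injective_iff_surjective.1 (injective_of_mem_isometries hU hg)).comp X.2

theorem orbit_poly (X : surj K V U) (φ : Module.Dual K (V →ₗ[K] U)) :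
    (fun g : Module.End K U => φ (LinearMap.lcomp K U X.1 g)) ∈ polyFun K (Module.End K U) :=
  linear_mem_polyFun K (φ ∘ₗ LinearMap.lcomp K U X.1)

/-- The comorphism of the orbit map `g ↦ g X`, `G(U) → L'`. -/
def orbitComorphism (hU : BU.Nondegenerate) (X : surj K V U) :
    coordRing K (surj K V U) →ₐ[K] coordRing K (isometries BU) :=
  comorphism K (LinearMap.lcomp K U X.1) (orbit_mapsTo hU X) (orbit_poly X)

theorem rhoMap_comp_of_mem_isometries (hV : BV.Nondegenerate) {g : Module.End K U}
    (hg : g ∈ isometries BU) (X : V →ₗ[K] U) : rhoMap hV BU (g ∘ₗ X) = rhoMap hV BU X := by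
  ext y
  refine sub_eq_zero.1 (hV.2 _ fun v => ?_)
  simp only [rhoMap, LinearMap.comp_apply, map_sub, ← adj_spec]
  rw [hg, sub_self]

theorem orbitComorphism_comp_rhoComorphism (hε : ε = 1 ∨ ε = -1) (hV : IsQuadraticSpace BV ε)
    (hU : IsQuadraticSpace BU (-ε)) (X : surj K V U) :
    (orbitComorphism hU.nondegenerate X).comp (rhoComorphism hε hV hU) =
      (Algebra.ofId K _).comp (evalAt K _ ⟨_, rhoMap_mapsTo hε hV hU X.2⟩) := by
  ext f g
  exact congrArg f.1 (Subtype.ext (rhoMap_comp_of_mem_isometries hV.nondegenerate g.2 X.1))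

variable {m n : Type} [Fintype m] [Fintype n] [DecidableEq m] [DecidableEq n]
  (bV : Module.Basis n K V) (bU : Module.Basis m K U)

open LinearMap in
theorem genMat_map_orbitComorphism (hU : BU.Nondegenerate) (X : surj K V U) :
    (genMat bV bU (surj K V U)).map (orbitComorphism hU X) =
      genMat bU bU (isometries BU) *
        (toMatrix bV bU X.1).map (algebraMap K (coordRing K (isometries BU))) := by
  refine matrix_coordRing_ext fun g => ?_
  rw [Matrix.map_mul, map_algebraMap_map, genMat_map_evalAt, Algebra.algebraMap_self,
    RingHom.coe_id, Matrix.map_id, ← toMatrix_comp]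
  exact genMat_map_evalAt bV bU (surj K V U) ⟨_, orbit_mapsTo hU X g.2⟩

open LinearMap in
/-- A point of `L'` in the fiber of `ρ` over `ρ(X)` is in the orbit of `X`. -/
theorem exists_algHom_comp_orbitComorphism [IsAlgClosed K] (h2 : (2 : K) ≠ 0)
    (hε : ε = 1 ∨ ε = -1) (hV : IsQuadraticSpace BV ε) (hU : IsQuadraticSpace BU (-ε))
    (X : surj K V U) {B : Type*} [CommRing B] [Algebra K B] (a : coordRing K (surj K V U) →ₐ[K] B)
    (ha : a.comp (rhoComorphism hε hV hU) =
      (Algebra.ofId K B).comp (evalAt K _ ⟨_, rhoMap_mapsTo hε hV hU X.2⟩)) :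
    ∃ χ : coordRing K (isometries BU) →ₐ[K] B, χ.comp (orbitComorphism hU.nondegenerate X) = a := by
  let bV := Module.finBasis K V
  let bU := Module.finBasis K U
  have hε' : -ε = 1 ∨ -ε = -1 := by rcases hε with rfl | rfl <;> simp
  obtain ⟨s, hs⟩ := X.1.exists_rightInverse_of_surjective (LinearMap.range_eq_top.2 X.2)
  have hXs : (toMatrix bV bU X.1).map (algebraMap K B) * (toMatrix bU bV s).map (algebraMap K B) =
      1 := by
    rw [← Matrix.map_mul, ← toMatrix_comp, hs, toMatrix_id, matrix_map_one]
  have hJ : IsUnit ((toMatrix₂ bU bU BU).map (algebraMap K B)) :=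
    isUnit_map_algebraMap (isUnit_gram bU hU.nondegenerate)
  have h1 := congrArg (fun M => M.map a) (gram_mul_genMat_map_rhoComorphism bV bU hε hV hU)
  simp only [Matrix.transpose_map, Matrix.map_mul, map_algebraMap_map] at h1
  have h3 : ((genMat bV bV (rankLocus BV (Module.finrank K U))).map (rhoComorphism hε hV hU)).map a
      = (toMatrix bV bV (rhoMap hV.nondegenerate BU X.1)).map (algebraMap K B) := by
    rw [← genMat_map_evalAt bV bV (rankLocus BV (Module.finrank K U))
      ⟨_, rhoMap_mapsTo hε hV hU X.2⟩]
    ext i j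
    exact DFunLike.congr_fun ha _
  have h4 : (toMatrix₂ bV bV BV).map (algebraMap K B) *
      (toMatrix bV bV (rhoMap hV.nondegenerate BU X.1)).map (algebraMap K B) =
      ((toMatrix bV bU X.1).map (algebraMap K B)).transpose *
        (toMatrix₂ bU bU BU).map (algebraMap K B) *
        (toMatrix bV bU X.1).map (algebraMap K B) := by
    rw [← Matrix.map_mul, toMatrix_rhoMap bV bU, Matrix.map_mul, Matrix.map_mul,
      Matrix.transpose_map]
  rw [h3, h4] at h1
  set Y := (genMat bV bU (surj K V U)).map a with hY
  set J := (toMatrix₂ bU bU BU).map (algebraMap K B)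
  set X₀ := (toMatrix bV bU X.1).map (algebraMap K B)
  set S := (toMatrix bU bV s).map (algebraMap K B)
  have hXs' : S.transpose * X₀.transpose = 1 := by
    rw [← Matrix.transpose_mul, hXs, Matrix.transpose_one]
  -- The only candidate for `g` with `g X₀ = Y` is `Y S`, since `S` is a right inverse of `X₀`. It
  -- is an isometry because `Yᵀ J Y = X₀ᵀ J X₀`.
  have hg : (Y * S).transpose * J * (Y * S) = J := by
    rw [transpose_mul_mul_mul, ← h1]
    simp only [Matrix.mul_assoc, hXs]
    rw [← Matrix.mul_assoc, hXs', Matrix.one_mul, Matrix.mul_one]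
  have hYS : Y * S * X₀ = Y := by
    -- Both sides are `J X₀`, and the left factor `gᵀ J` is invertible.
    have h5 : (Y * S).transpose * J * Y = (Y * S).transpose * J * (Y * S * X₀) := by
      rw [← Matrix.mul_assoc _ (Y * S) X₀, hg, Matrix.transpose_mul, Matrix.mul_assoc,
        Matrix.mul_assoc, ← Matrix.mul_assoc _ J, ← h1]
      simp only [← Matrix.mul_assoc, hXs', Matrix.one_mul]
    obtain ⟨N, hN⟩ : ∃ N, N * ((Y * S).transpose * J) = 1 := by
      refine IsUnit.exists_left_inv ((Matrix.isUnit_iff_isUnit_det _).2 ?_)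
      have h6 := congrArg Matrix.det hg
      rw [Matrix.det_mul] at h6
      exact isUnit_of_mul_isUnit_left (h6 ▸ (Matrix.isUnit_iff_isUnit_det _).1 hJ)
    have h6 := congrArg (N * ·) h5
    simpa only [← Matrix.mul_assoc _ _ Y, ← Matrix.mul_assoc _ _ (Y * S * X₀), hN, Matrix.one_mul]
      using h6.symm
  obtain ⟨χ, hχ⟩ := exists_algHom_genMat_isometries bU h2 hε' hU (Y * S) hg
  refine ⟨χ, genMat_algHom_ext bV bU ?_⟩
  have h7 := congrArg (fun M => M.map χ) (genMat_map_orbitComorphism bV bU hU.nondegenerate X)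
  simp only [Matrix.map_mul, map_algebraMap_map, hχ] at h7
  rw [hYS] at h7
  exact h7

/-- The action on a surjective map is free: `g` is recovered from `g X` with a right inverse of `X`.
-/
theorem algHom_eq_of_comp_orbitComorphism (hU : BU.Nondegenerate) (X : surj K V U) {B : Type*}
    [CommRing B] [Algebra K B] {χ₁ χ₂ : coordRing K (isometries BU) →ₐ[K] B}
    (h : χ₁.comp (orbitComorphism hU X) = χ₂.comp (orbitComorphism hU X)) : χ₁ = χ₂ := by
  let bV := Module.finBasis K V
  let bU := Module.finBasis K U
  obtain ⟨s, hs⟩ := X.1.exists_rightInverse_of_surjective (LinearMap.range_eq_top.2 X.2)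
  have h1 (χ : coordRing K (isometries BU) →ₐ[K] B) :
      ((genMat bV bU (surj K V U)).map (χ.comp (orbitComorphism hU X))) *
        (LinearMap.toMatrix bU bV s).map (algebraMap K B) =
      (genMat bU bU (isometries BU)).map χ := by
    have h2 := congrArg (fun M => M.map χ) (genMat_map_orbitComorphism bV bU hU X)
    simp only [Matrix.map_mul, map_algebraMap_map] at h2
    refine (congrArg (· * (LinearMap.toMatrix bU bV s).map (algebraMap K B)) h2).trans ?_
    rw [Matrix.mul_assoc, ← Matrix.map_mul, ← LinearMap.toMatrix_comp, hs, LinearMap.toMatrix_id,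
      matrix_map_one, Matrix.mul_one]
  refine genMat_algHom_ext bU bU ?_
  rw [← h1, ← h1, h]

/-- The affine form of the statement on fibers: over any test ring, the points with the same value
of `ρ` as `X` form a torsor under the isometries, trivialized by `X`. -/
theorem isPushout_orbitComorphism [IsAlgClosed K] (h2 : (2 : K) ≠ 0)
    (hε : ε = 1 ∨ ε = -1) (hV : IsQuadraticSpace BV ε) (hU : IsQuadraticSpace BU (-ε))
    (X : surj K V U) :
    IsPushout (CommRingCat.ofHom (rhoComorphism hε hV hU).toRingHom)
      (CommRingCat.ofHom (evalAt K (rankLocus BV (Module.finrank K U))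
        ⟨_, rhoMap_mapsTo hε hV hU X.2⟩).toRingHom)
      (CommRingCat.ofHom (orbitComorphism hU.nondegenerate X).toRingHom)
      (CommRingCat.ofHom (algebraMap K (coordRing K (isometries BU)))) := by
  have key (s : Limits.PushoutCocone (CommRingCat.ofHom (rhoComorphism hε hV hU).toRingHom)
      (CommRingCat.ofHom (evalAt K (rankLocus BV (Module.finrank K U))
        ⟨_, rhoMap_mapsTo hε hV hU X.2⟩).toRingHom)) :
      ∃ l : CommRingCat.of (coordRing K (isometries BU)) ⟶ s.pt,
        CommRingCat.ofHom (orbitComorphism hU.nondegenerate X).toRingHom ≫ l = s.inl ∧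
        CommRingCat.ofHom (algebraMap K (coordRing K (isometries BU))) ≫ l = s.inr ∧
        ∀ l', CommRingCat.ofHom (orbitComorphism hU.nondegenerate X).toRingHom ≫ l' = s.inl →
          CommRingCat.ofHom (algebraMap K (coordRing K (isometries BU))) ≫ l' = s.inr →
          l' = l := by
    -- The leg from `K` makes the test ring a `K`-algebra, and commutativity of the cocone makes the
    -- other leg `K`-linear.
    let _ : Algebra K s.pt := s.inr.hom.toAlgebra
    have hw (r) : s.inl.hom (rhoComorphism hε hV hU r) = s.inr.hom (evalAt K _ _ r) :=
      congrArg (fun t => t.hom r) s.condition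
    let a : coordRing K (surj K V U) →ₐ[K] s.pt :=
      { s.inl.hom with
        commutes' := fun c => by
          have := hw (algebraMap K _ c)
          rwa [AlgHom.commutes, AlgHom.commutes] at this }
    obtain ⟨χ, hχ⟩ := exists_algHom_comp_orbitComorphism h2 hε hV hU X a (AlgHom.ext hw)
    refine ⟨CommRingCat.ofHom χ.toRingHom, ?_, ?_, fun l h1 h3 => ?_⟩
    · ext x
      exact DFunLike.congr_fun hχ x
    · ext x
      exact χ.commutes x
    · let χ' : coordRing K (isometries BU) →ₐ[K] s.pt :=
        { l.hom with commutes' := fun c => congrArg (fun t => t.hom c) h3 }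
      have h4 : χ' = χ := algHom_eq_of_comp_orbitComorphism hU.nondegenerate X (by
        rw [hχ]
        ext x
        exact congrArg (fun t => t.hom x) h1)
      ext x
      exact DFunLike.congr_fun h4 x
  choose l hl using key
  refine ⟨⟨?_⟩, ⟨Limits.PushoutCocone.IsColimit.mk _ l (fun s => (hl s).1) (fun s => (hl s).2.1)
    fun s l' => (hl s).2.2 l'⟩⟩
  ext r : 2
  exact DFunLike.congr_fun (orbitComorphism_comp_rhoComorphism hε hV hU X) r

open LinearMap in
/-- Every maximal ideal of the coordinate ring of `G(U)` is a point. -/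
theorem isIso_ι_isometries [IsAlgClosed K] (BU : LinearMap.BilinForm K U) :
    IsIso (variety.ι (isometries_locallyClosed BU)) := by
  have htop : varietyOpen K (isometries_locallyClosed BU) = ⊤ := by
    refine top_unique fun p _ => ?_
    obtain ⟨M, hM, hpM⟩ := Ideal.exists_le_maximal _ p.2.ne_top
    obtain ⟨χ, hχ⟩ := exists_algHom_ker_eq_of_isMaximal (K := K) M
    let bU := Module.finBasis K U
    -- `G(U)` is closed: its equations hold in `K[G(U)]`, so every `K`-point of this ring is an
    -- isometry.
    have h1 : (genMat bU bU (isometries BU)).transpose *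
        (toMatrix₂ bU bU BU).map (algebraMap K (coordRing K (isometries BU))) *
        genMat bU bU (isometries BU) =
        (toMatrix₂ bU bU BU).map (algebraMap K (coordRing K (isometries BU))) := by
      refine matrix_coordRing_ext fun g => ?_
      rw [Matrix.map_mul, Matrix.map_mul, Matrix.transpose_map, map_algebraMap_map,
        genMat_map_evalAt, Algebra.algebraMap_self, RingHom.coe_id, Matrix.map_id]
      exact (mem_isometries_iff bU _).1 g.2
    have h2 := congrArg (fun M => M.map χ) h1
    simp only [Matrix.map_mul, Matrix.transpose_map, map_algebraMap_map, Algebra.algebraMap_self,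
      RingHom.coe_id, Matrix.map_id] at h2
    have h3 : Matrix.toLin bU bU ((genMat bU bU (isometries BU)).map χ) ∈ isometries BU := by
      rwa [mem_isometries_iff bU, toMatrix_toLin]
    have h4 : χ = evalAt K _ ⟨_, h3⟩ := genMat_algHom_ext bU bU (by
      rw [genMat_map_evalAt, toMatrix_toLin])
    refine ⟨⟨_, h3⟩, hpM.trans ?_⟩
    rw [← hχ]
    exact (congrArg (fun t : coordRing K (isometries BU) →ₐ[K] K => RingHom.ker t) h4).le
  change IsIso (varietyOpen K (isometries_locallyClosed BU)).ι
  rw [htop]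
  exact inferInstanceAs (IsIso (Scheme.topIso _).hom)

/-- The scheme-theoretic fibers of `ρ` are isomorphic to `G(U)`. -/
theorem exists_fiber_rhoMor_iso [IsAlgClosed K] (h2 : (2 : K) ≠ 0)
    (hε : ε = 1 ∨ ε = -1) (hV : IsQuadraticSpace BV ε) (hU : IsQuadraticSpace BU (-ε))
    (X : surj K V U) :
    ∃ e : (rhoMor hε hV hU).fiber (variety.pt K (rankLocus_locallyClosed BV (Module.finrank K U))
        ⟨_, rhoMap_mapsTo hε hV hU X.2⟩) ≅ variety K (isometries_locallyClosed BU),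
      e.hom ≫ variety.toSpec K (isometries_locallyClosed BU) =
        (rhoMor hε hV hU).fiberι _ ≫ variety.toSpec K surj_locallyClosed := by
  have := isIso_ι_isometries BU
  let orb : variety K (isometries_locallyClosed BU) ⟶ variety K (surj_locallyClosed (V := V)) :=
    variety.map K _ _ (LinearMap.lcomp K U X.1) (orbit_mapsTo hU.nondegenerate X) (orbit_poly X)
  have horb : orb ≫ variety.ι _ = variety.ι _ ≫
      Spec.map (CommRingCat.ofHom (orbitComorphism hU.nondegenerate X).toRingHom) :=
    variety.map_comp_ι _ _ _ _ _
  have hrho : rhoMor hε hV hU ≫ variety.ι _ = variety.ι _ ≫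
      Spec.map (CommRingCat.ofHom (rhoComorphism hε hV hU).toRingHom) :=
    variety.map_comp_ι _ _ _ _ _
  have h1 := isPullback_SpecMap_of_isPushout _ _ _ _ (isPushout_orbitComorphism h2 hε hV hU X)
  have h3 : IsPullback (orb ≫ variety.ι _) (variety.toSpec K (isometries_locallyClosed BU))
      (Spec.map (CommRingCat.ofHom (rhoComorphism hε hV hU).toRingHom))
      (Spec.map (CommRingCat.ofHom (evalAt K (rankLocus BV (Module.finrank K U))
        ⟨_, rhoMap_mapsTo hε hV hU X.2⟩).toRingHom)) :=
    h1.of_iso (asIso (variety.ι (isometries_locallyClosed BU))).symm (Iso.refl _) (Iso.refl _)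
      (Iso.refl _) (by simp [horb]) (by simp [variety.toSpec_eq]) (by simp) (by simp)
  -- The square over the affine schemes restricts to the open varieties: the orbit map already lands
  -- in `L'`, and the open immersion of the rank locus is a monomorphism.
  have h4 := isPullback_of_comp_mono_fst h3
  rw [← hrho, ← variety.ptHom_comp_ι
    (rankLocus_locallyClosed BV (Module.finrank K U))] at h4
  obtain ⟨e, he⟩ := exists_fiber_iso_of_isPullback (rhoMor hε hV hU)
    (variety.ptHom_apply _ _ _) (variety.ptHom_comp_toSpec _ _) (isPullback_of_comp_mono h4)
  refine ⟨e, ?_⟩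
  rw [← he, Category.assoc]
  congr 1
  rw [variety.toSpec_eq, variety.toSpec_eq, ← Category.assoc, horb, Category.assoc, ← Spec.map_comp,
    ← CommRingCat.ofHom_comp]
  congr 4

end Orbit

/-! ### Isometric embeddings of forms -/

section Embedding

variable {K : Type u} [Field K] {ε : K}

/-- A nonzero quadratic space contains a nonzero nondegenerate subspace of a shape that depends
only on the type. -/
theorem exists_gram_of_type [IsAlgClosed K] (h2 : (2 : K) ≠ 0) (hε : ε = 1 ∨ ε = -1) :
    ∃ (k : ℕ) (G : Matrix (Fin k) (Fin k) K), 0 < k ∧ IsUnit G.det ∧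
      ∀ (W : Type u) [AddCommGroup W] [Module K W] [Nontrivial W] (b : LinearMap.BilinForm K W),
        b.Nondegenerate → (∀ x y, b x y = ε * b y x) →
          ∃ e : Fin k → W, ∀ i j, b (e i) (e j) = G i j := by
  rcases hε with rfl | rfl
  · refine ⟨1, 1, one_pos, by simp, fun W _ _ _ b hb hs => ?_⟩
    -- Polarization: if all `b x x` vanish, so does `2 b x y`. The vector is then normalized by a
    -- square root.
    obtain ⟨x, hx⟩ : ∃ x, b x x ≠ 0 := by
      by_contra! h
      obtain ⟨x, hx⟩ := exists_ne (0 : W)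
      refine hx (hb.1 x fun y => ?_)
      have h1 := h (x + y)
      simp only [map_add, LinearMap.add_apply, h, zero_add, add_zero] at h1
      rw [hs y x, one_mul, ← two_mul] at h1
      exact (mul_eq_zero.1 h1).resolve_left h2
    obtain ⟨z, hz⟩ := IsAlgClosed.exists_pow_nat_eq (b x x) (n := 2) two_pos
    have hz0 : z ≠ 0 := by rintro rfl; exact hx (by rw [← hz]; simp)
    refine ⟨fun _ => z⁻¹ • x, fun i j => ?_⟩
    rw [Subsingleton.elim i j, Matrix.one_apply_eq]
    simp only [map_smul, LinearMap.smul_apply, smul_eq_mul, ← hz]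
    field_simp
  -- In the alternating case the common piece is a hyperbolic plane.
  · refine ⟨2, !![0, 1; -1, 0], two_pos, by simp, fun W _ _ _ b hb hs => ?_⟩
    have hz (x : W) : b x x = 0 := by
      have h1 : 2 * b x x = 0 := by linear_combination hs x x
      exact (mul_eq_zero.1 h1).resolve_left h2
    obtain ⟨x, hx⟩ := exists_ne (0 : W)
    obtain ⟨y, hy⟩ : ∃ y, b x y ≠ 0 := by
      by_contra! h
      exact hx (hb.1 x h)
    refine ⟨![x, (b x y)⁻¹ • y], fun i j => ?_⟩
    have h3 := hs y x
    fin_cases i <;> fin_cases j <;> simp [hz, h3, hy]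

/-- Orthogonal projection to the span of vectors with invertible Gram matrix. -/
theorem exists_orthogonal_coords {W : Type*} [AddCommGroup W] [Module K W]
    {b : LinearMap.BilinForm K W} {k : ℕ} {G : Matrix (Fin k) (Fin k) K} (hG : IsUnit G.det)
    {e : Fin k → W} (he : ∀ i j, b (e i) (e j) = G i j) :
    ∃ c : W →ₗ[K] (Fin k → K), c ∘ₗ Fintype.linearCombination K e = LinearMap.id ∧
      ∀ w, c w = 0 → ∀ i, b (e i) w = 0 := by
  let c₀ : W →ₗ[K] (Fin k → K) := LinearMap.pi fun i => b (e i)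
  refine ⟨G⁻¹.mulVecLin ∘ₗ c₀, ?_, fun w hw i => ?_⟩
  · have h1 : c₀ ∘ₗ Fintype.linearCombination K e = G.mulVecLin := by
      refine LinearMap.pi_ext' fun j => LinearMap.ext_ring ?_
      funext i
      simp [c₀, he]
    rw [LinearMap.comp_assoc, h1, ← Matrix.mulVecLin_mul, Matrix.nonsing_inv_mul _ hG,
      Matrix.mulVecLin_one]
  · have h1 : G.mulVec (G⁻¹.mulVec (c₀ w)) = 0 := by
      rw [show G⁻¹.mulVec (c₀ w) = 0 from hw, Matrix.mulVec_zero]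
    rw [Matrix.mulVec_mulVec, Matrix.mul_nonsing_inv _ hG, Matrix.one_mulVec] at h1
    exact congrFun h1 i

theorem nondegenerate_of_left {W : Type*} [AddCommGroup W] [Module K W]
    {b : LinearMap.BilinForm K W} (hs : ∀ x y, b x y = ε * b y x)
    (h : ∀ x, (∀ y, b x y = 0) → x = 0) : b.Nondegenerate :=
  ⟨h, fun y hy => h y fun x => by rw [hs, hy, mul_zero]⟩

/-- `ker c` is orthogonal to the `e i` and together with them spans `W`, so its radical lies in the
radical of `b`. -/
theorem nondegenerate_restrict_ker {W : Type*} [AddCommGroup W] [Module K W]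
    {b : LinearMap.BilinForm K W} (hb : b.Nondegenerate) (hs : ∀ x y, b x y = ε * b y x) {k : ℕ}
    {e : Fin k → W} {c : W →ₗ[K] (Fin k → K)}
    (hc : c ∘ₗ Fintype.linearCombination K e = LinearMap.id)
    (hc' : ∀ w, c w = 0 → ∀ i, b (e i) w = 0) :
    (b.restrict (LinearMap.ker c)).Nondegenerate := by
  refine nondegenerate_of_left (fun x y => hs x y) fun x hx => ?_
  refine Subtype.ext (hb.1 _ fun y => ?_)
  have h1 : c (y - Fintype.linearCombination K e (c y)) = 0 := by
    rw [map_sub, sub_eq_zero]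
    exact (LinearMap.congr_fun hc (c y)).symm
  have h3 : b x (y - Fintype.linearCombination K e (c y)) = 0 := hx ⟨_, h1⟩
  rw [map_sub, sub_eq_zero] at h3
  rw [h3, Fintype.linearCombination_apply, map_sum]
  refine Finset.sum_eq_zero fun i _ => ?_
  rw [map_smul, hs, hc' _ x.2, mul_zero, smul_zero]

theorem finrank_ker_add_of_comp_eq_id {W : Type*} [AddCommGroup W] [Module K W]
    [FiniteDimensional K W] {k : ℕ} {c : W →ₗ[K] (Fin k → K)} {s : (Fin k → K) →ₗ[K] W}
    (hc : c ∘ₗ s = LinearMap.id) :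
    Module.finrank K (LinearMap.ker c) + k = Module.finrank K W := by
  have h1 : LinearMap.range c = ⊤ :=
    LinearMap.range_eq_top.2 fun x => ⟨s x, LinearMap.congr_fun hc x⟩
  have := c.finrank_range_add_finrank_ker
  rw [h1, finrank_top, Module.finrank_fin_fun] at this
  omega

/-- A quadratic space embeds into every quadratic space of the same type and of no smaller
dimension. -/
theorem exists_isometry_of_finrank_le [IsAlgClosed K] (h2 : (2 : K) ≠ 0) (hε : ε = 1 ∨ ε = -1)
    {W V : Type u} [AddCommGroup W] [Module K W] [FiniteDimensional K W] [AddCommGroup V]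
    [Module K V] [FiniteDimensional K V] {b : LinearMap.BilinForm K W}
    {B : LinearMap.BilinForm K V} (hb : IsQuadraticSpace b ε) (hB : IsQuadraticSpace B ε)
    (hdim : Module.finrank K W ≤ Module.finrank K V) :
    ∃ f : W →ₗ[K] V, ∀ x y, B (f x) (f y) = b x y := by
  obtain ⟨k, G, hk, hG, H⟩ := exists_gram_of_type h2 hε
  induction hd : Module.finrank K W using Nat.strong_induction_on generalizing W V with
  | _ d ih =>
  rcases Nat.eq_zero_or_pos d with rfl | hpos
  · have : Subsingleton W := Module.finrank_zero_iff.1 hd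
    exact ⟨0, fun x y => by rw [Subsingleton.elim x 0]; simp⟩
  have : Nontrivial W := Module.nontrivial_of_finrank_pos (R := K) (by omega)
  have : Nontrivial V := Module.nontrivial_of_finrank_pos (R := K) (by omega)
  obtain ⟨e, he⟩ := H W b hb.nondegenerate hb.symm
  obtain ⟨e', he'⟩ := H V B hB.nondegenerate hB.symm
  obtain ⟨c, hc, hc0⟩ := exists_orthogonal_coords hG he
  obtain ⟨c', hc', hc0'⟩ := exists_orthogonal_coords hG he'
  have hd1 := finrank_ker_add_of_comp_eq_id hc
  have hd1' := finrank_ker_add_of_comp_eq_id hc'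
  -- Both spaces contain a piece with Gram matrix `G`; the induction runs on the orthogonal
  -- complements, whose dimensions both drop by `k > 0`.
  obtain ⟨f, hf⟩ := ih (Module.finrank K (LinearMap.ker c)) (by omega)
    (W := LinearMap.ker c) (V := LinearMap.ker c') (b := b.restrict _) (B := B.restrict _)
    ⟨nondegenerate_restrict_ker hb.nondegenerate hb.symm hc hc0, fun x y => hb.symm x y⟩
    ⟨nondegenerate_restrict_ker hB.nondegenerate hB.symm hc' hc0', fun x y => hB.symm x y⟩
    (by omega) rfl
  let q : W →ₗ[K] LinearMap.ker c :=
    (LinearMap.id - Fintype.linearCombination K e ∘ₗ c).codRestrict _ fun w => by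
      rw [LinearMap.mem_ker, LinearMap.sub_apply, map_sub, sub_eq_zero]
      exact (LinearMap.congr_fun hc (c w)).symm
  have hq (w : W) : w = Fintype.linearCombination K e (c w) + q w := by
    simp [q]
  have orth {W : Type u} [AddCommGroup W] [Module K W] {b : LinearMap.BilinForm K W}
      {e : Fin k → W} (hb : ∀ x y, b x y = ε * b y x) (he : ∀ i j, b (e i) (e j) = G i j)
      (x y : Fin k → K) {u v : W} (hu : ∀ i, b (e i) u = 0) (hv : ∀ i, b (e i) v = 0) :
      b (Fintype.linearCombination K e x + u) (Fintype.linearCombination K e y + v) =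
        ∑ i, ∑ j, x i * (y j * G i j) + b u v := by
    have hu' (i) : b u (e i) = 0 := by rw [hb, hu, mul_zero]
    simp only [Fintype.linearCombination_apply, map_add, LinearMap.add_apply, map_sum, map_smul,
      LinearMap.sum_apply, LinearMap.smul_apply, hu', hv, smul_eq_mul, he, mul_zero,
      Finset.sum_const_zero, add_zero, zero_add]
    rw [Finset.sum_comm]
    simp only [Finset.mul_sum, mul_left_comm]
  refine ⟨Fintype.linearCombination K e' ∘ₗ c + (LinearMap.ker c').subtype ∘ₗ f ∘ₗ q,
    fun x y => ?_⟩
  have h1 := orth hb.symm he (c x) (c y) (hc0 _ (q x).2) (hc0 _ (q y).2)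
  have h3 := orth hB.symm he' (c x) (c y) (hc0' _ (f (q x)).2) (hc0' _ (f (q y)).2)
  have h4 : B (f (q x)) (f (q y)) = b (q x) (q y) := hf _ _
  rw [← hq, ← hq, ← h4, ← h3] at h1
  exact h1.symm

/-- A possibly degenerate form embeds into quadratic spaces of large dimension. -/
theorem exists_injective_isometry [IsAlgClosed K] (h2 : (2 : K) ≠ 0) (hε : ε = 1 ∨ ε = -1)
    {W V : Type u} [AddCommGroup W] [Module K W] [FiniteDimensional K W] [AddCommGroup V]
    [Module K V] [FiniteDimensional K V] {b : LinearMap.BilinForm K W}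
    {B : LinearMap.BilinForm K V} (hb : ∀ x y, b x y = ε * b y x) (hB : IsQuadraticSpace B ε)
    (hdim : 2 * Module.finrank K W ≤ Module.finrank K V + Module.finrank K (LinearMap.range b)) :
    ∃ f : W →ₗ[K] V, Function.Injective f ∧ ∀ x y, B (f x) (f y) = b x y := by
  have hεε : ε * ε = 1 := by rcases hε with rfl | rfl <;> simp
  obtain ⟨p, hp⟩ := (LinearMap.ker b).subtype.exists_leftInverse_of_injective
    (Submodule.ker_subtype _)
  let R := LinearMap.ker b
  -- The radical `R` is paired with its dual through a retraction `p` onto it. The result is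
  -- nondegenerate of dimension `dim W + dim R = 2 dim W - rank b`, the number in the hypothesis.
  let b' : LinearMap.BilinForm K (W × Module.Dual K R) :=
    LinearMap.mk₂ K (fun x y => b x.1 y.1 + x.2 (p y.1) + ε * y.2 (p x.1))
      (fun x y z => by simp; ring) (fun c x y => by simp; ring) (fun x y z => by simp; ring)
      (fun c x y => by simp; ring)
  have hb'apply (x y) : b' x y = b x.1 y.1 + x.2 (p y.1) + ε * y.2 (p x.1) := rfl
  have hs (x y) : b' x y = ε * b' y x := by
    rw [hb'apply, hb'apply, hb]
    linear_combination (-x.2 (p y.1)) * hεε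
  have hε0 : ε ≠ 0 := by rintro rfl; simp at hεε
  have hb' : IsQuadraticSpace b' ε := by
    refine ⟨nondegenerate_of_left hs fun x hx => ?_, hs⟩
    have h1 : p x.1 = 0 := by
      refine (Module.forall_dual_apply_eq_zero_iff K _).1 fun ψ => ?_
      have := hx (0, ψ)
      rw [hb'apply] at this
      simpa [hε0] using this
    have h3 : x.2 = 0 := by
      ext y
      have := hx (y, 0)
      have hy : p y = y := LinearMap.congr_fun hp y
      have hy' : b x.1 y = 0 := by rw [hb, y.2, LinearMap.zero_apply, mul_zero]
      rw [hb'apply] at this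
      simpa [hy, hy'] using this
    have h4 : x.1 ∈ R := by
      refine LinearMap.mem_ker.2 (LinearMap.ext fun y => ?_)
      have := hx (y, 0)
      rw [hb'apply] at this
      simpa [h3] using this
    have h5 : p x.1 = ⟨x.1, h4⟩ := LinearMap.congr_fun hp ⟨x.1, h4⟩
    rw [h1] at h5
    exact Prod.ext (congrArg Subtype.val h5).symm h3
  obtain ⟨F, hF⟩ := exists_isometry_of_finrank_le h2 hε hb' hB (by
    rw [Module.finrank_prod, Subspace.dual_finrank_eq]
    have := b.finrank_range_add_finrank_ker
    change Module.finrank K W + Module.finrank K (LinearMap.ker b) ≤ _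
    omega)
  refine ⟨F ∘ₗ LinearMap.inl K W _, ?_, fun x y => ?_⟩
  · rw [LinearMap.coe_comp]
    refine Function.Injective.comp ?_ LinearMap.inl_injective
    rw [injective_iff_map_eq_zero]
    exact fun x hx => hb'.nondegenerate.1 x fun y => by rw [← hF, hx, map_zero]; rfl
  · rw [LinearMap.comp_apply, LinearMap.comp_apply, hF, hb'apply]
    simp

end Embedding

/-! ### The images of `π` and `ρ` -/

section Images

variable {K : Type u} [Field K] {V U : Type u} [AddCommGroup V] [Module K V]
  [FiniteDimensional K V] [AddCommGroup U] [Module K U] [FiniteDimensional K U]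
  {BV : LinearMap.BilinForm K V} {BU : LinearMap.BilinForm K U} {ε : K}

/-- Since the types of `V` and `U` are opposite, the double adjoint is `-1`; this is the origin of
the sign. -/
theorem exists_adj_eq (hε : ε = 1 ∨ ε = -1) (hV : IsQuadraticSpace BV ε)
    (hU : IsQuadraticSpace BU (-ε)) (f : U →ₗ[K] V) :
    ∃ X : V →ₗ[K] U, adj hV.nondegenerate BU X = f := by
  refine ⟨-adj hU.nondegenerate BV f, (adj_unique hV.nondegenerate BU _ _ fun v u => ?_).symm⟩
  have h1 := adj_spec hU.nondegenerate BV f u v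
  rw [hV.symm, hU.symm] at h1
  rw [LinearMap.neg_apply, map_neg, LinearMap.neg_apply]
  rcases hε with rfl | rfl
  · linear_combination -h1
  · linear_combination h1

theorem surjective_of_adj_injective (hV : BV.Nondegenerate) (hU : BU.Nondegenerate)
    {X : V →ₗ[K] U} (hX : Function.Injective (adj hV BU X)) : Function.Surjective X := by
  rw [← LinearMap.dualMap_injective_iff, injective_iff_map_eq_zero]
  intro φ hφ
  obtain ⟨u, rfl⟩ := (LinearMap.BilinForm.toDual BU.flip hU.flip).surjective φ
  have h1 : adj hV BU X u = 0 := by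
    refine hV.2 _ fun v => ?_
    rw [← adj_spec]
    exact LinearMap.congr_fun hφ v
  rw [(injective_iff_map_eq_zero _).1 hX u h1, map_zero]

theorem apply_comm_of_mem_lieAlg {B : LinearMap.BilinForm K V} (hB : ∀ x y, B x y = ε * B y x)
    {D : Module.End K V} (hD : D ∈ lieAlg B) (x y : V) : B (D x) y = -ε * B (D y) x := by
  have := hD x y
  rw [this, Pi.neg_apply, map_neg, hB]
  ring

/-- The injection `X*` sends `ker (X X*)` into `ker X`, of dimension `n - m`, which gives the bound
on the rank. Conversely the form `(D x, y)` of `U` has type `ε` and the rank of `D`; an injective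
isometry of it into `V` is `X*` for the required `X`. -/
theorem image_piMap [IsAlgClosed K] (h2 : (2 : K) ≠ 0) (hε : ε = 1 ∨ ε = -1)
    (hV : IsQuadraticSpace BV ε) (hU : IsQuadraticSpace BU (-ε)) :
    piMap hV.nondegenerate BU '' surj K V U =
      {D | D ∈ lieAlg BU ∧ 2 * (Module.finrank K U : ℤ) - Module.finrank K V ≤
        Module.finrank K (LinearMap.range D)} := by
  ext D
  constructor
  · rintro ⟨X, hX, rfl⟩
    refine ⟨piMap_mem hε hV hU X, ?_⟩
    have h1 := (piMap hV.nondegenerate BU X).finrank_range_add_finrank_ker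
    have h3 := X.finrank_range_add_finrank_ker
    rw [LinearMap.range_eq_top.2 hX, finrank_top] at h3
    have h4 : Module.finrank K (LinearMap.ker (piMap hV.nondegenerate BU X)) ≤
        Module.finrank K (LinearMap.ker X) := by
      refine LinearMap.finrank_le_finrank_of_injective
        (f := (adj hV.nondegenerate BU X).restrict fun u hu => hu) ?_
      intro x y hxy
      exact Subtype.ext (adj_injective hV.nondegenerate hU.nondegenerate hX
        (congrArg Subtype.val hxy))
    omega
  · rintro ⟨hD, hrank⟩
    have hker : LinearMap.ker (BU ∘ₗ D) = LinearMap.ker D :=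
      LinearMap.ker_comp_of_ker_eq_bot _ (LinearMap.ker_eq_bot'.2 fun x hx =>
        hU.nondegenerate.1 x fun y => by rw [hx, LinearMap.zero_apply])
    have h1 := D.finrank_range_add_finrank_ker
    have h3 := (BU ∘ₗ D).finrank_range_add_finrank_ker
    rw [hker] at h3
    obtain ⟨f, hf, hfD⟩ := exists_injective_isometry h2 hε (b := BU ∘ₗ D) (B := BV)
      (fun x y => by
        have := apply_comm_of_mem_lieAlg hU.symm hD x y
        rwa [neg_neg] at this) hV (by omega)
    obtain ⟨X, rfl⟩ := exists_adj_eq hε hV hU f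
    refine ⟨X, surjective_of_adj_injective hV.nondegenerate hU.nondegenerate hf, ?_⟩
    ext x
    refine sub_eq_zero.1 (hU.nondegenerate.1 _ fun y => ?_)
    rw [map_sub, LinearMap.sub_apply, sub_eq_zero, piMap, LinearMap.comp_apply,
      adj_spec hV.nondegenerate, hfD, LinearMap.comp_apply]

/-- The form `-(D x, y) = (x, D y)` has type `-ε` and radical `ker D`. On a complement `A` of `ker
D` it is nondegenerate of dimension `m`, so `A` is isometric to `U`, and `X` is the projection to
`A` followed by this isometry. -/
theorem image_rhoMap [IsAlgClosed K] (h2 : (2 : K) ≠ 0) (hε : ε = 1 ∨ ε = -1)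
    (hV : IsQuadraticSpace BV ε) (hU : IsQuadraticSpace BU (-ε)) :
    rhoMap hV.nondegenerate BU '' surj K V U = rankLocus BV (Module.finrank K U) := by
  refine Set.Subset.antisymm (Set.image_subset_iff.2 (rhoMap_mapsTo hε hV hU)) ?_
  rintro D ⟨hD, hrank⟩
  have hε' : -ε = 1 ∨ -ε = -1 := by rcases hε with rfl | rfl <;> simp
  obtain ⟨A, hA⟩ := (LinearMap.ker D).exists_isCompl
  have h1 := D.finrank_range_add_finrank_ker
  have h3 := Submodule.finrank_add_eq_of_isCompl hA
  let b : LinearMap.BilinForm K V := -(BV ∘ₗ D)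
  have hb (x y) : b x y = -BV (D x) y := rfl
  have hbs (x y) : b x y = -ε * b y x := by
    rw [hb, hb, apply_comm_of_mem_lieAlg hV.symm hD]; ring
  let P : V →ₗ[K] A := A.projectionOnto _ hA.symm
  have hP (x : V) : D (P x) = D x := by
    have : x - P x ∈ LinearMap.ker D := by
      rw [← Submodule.ker_projectionOnto hA.symm]
      rw [LinearMap.mem_ker, map_sub, Submodule.projectionOnto_apply_left, sub_self]
    rw [LinearMap.mem_ker, map_sub, sub_eq_zero] at this
    exact this.symm
  have hbP (x y) : b (P x) (P y) = b x y := by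
    rw [hb, hP, ← hb, hbs, hb, hP, ← hb, ← hbs]
  have hbA : IsQuadraticSpace (b.restrict A) (-ε) := by
    refine ⟨nondegenerate_of_left (fun x y => hbs x y) fun x hx => ?_, fun x y => hbs x y⟩
    have h4 : D x = 0 := by
      refine hV.nondegenerate.1 _ fun y => ?_
      have h5 : b x (P y) = 0 := hx (P y)
      rw [hbs, hb, hP, ← hb, ← hbs, hb, neg_eq_zero] at h5
      exact h5
    exact Subtype.ext (Submodule.disjoint_def.1 hA.disjoint _ h4 x.2)
  obtain ⟨f, hf⟩ := exists_isometry_of_finrank_le h2 hε' hbA hU (by omega)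
  have hfi : Function.Injective f := by
    rw [injective_iff_map_eq_zero]
    exact fun x hx => hbA.nondegenerate.1 x fun y => by rw [← hf, hx, map_zero]; rfl
  have hfs : Function.Surjective f :=
    (LinearMap.injective_iff_surjective_of_finrank_eq_finrank (by omega)).1 hfi
  refine ⟨f ∘ₗ P, hfs.comp (LinearMap.range_eq_top.1 (Submodule.range_projectionOnto _)), ?_⟩
  ext y
  refine sub_eq_zero.1 (hV.nondegenerate.2 _ fun v => ?_)
  have h4 : b v y = BV v (D y) := by
    rw [hb, hD, Pi.neg_apply, map_neg, neg_neg]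
  rw [map_sub, sub_eq_zero, rhoMap, LinearMap.comp_apply, ← adj_spec hV.nondegenerate, ← h4, ← hbP]
  exact hf _ _

end Images

end

end QuadraticPair

/-! ### The main theorem -/

theorem mainTheorem3 {K : Type u} [Field K] [IsAlgClosed K] (p : ℕ) [CharP K p] (hp : 2 < p)
    {V U : Type u} [AddCommGroup V] [Module K V] [FiniteDimensional K V]
    [AddCommGroup U] [Module K U] [FiniteDimensional K U]
    (ε : K) (hε : ε = 1 ∨ ε = -1)
    (BV : LinearMap.BilinForm K V) (BU : LinearMap.BilinForm K U)
    (hV : QuadraticPair.IsQuadraticSpace BV ε) (hU : QuadraticPair.IsQuadraticSpace BU (-ε))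
    (hdim : Module.finrank K U ≤ Module.finrank K V) :
    -- (1): smoothness of `π` on `L'`, and the image of `L'`
    (Smooth (QuadraticPair.piMor hε hV hU) ∧
      QuadraticPair.piMap hV.nondegenerate BU '' QuadraticPair.surj K V U =
        {D | D ∈ QuadraticPair.lieAlg BU ∧
          2 * (Module.finrank K U : ℤ) - Module.finrank K V ≤
            Module.finrank K (LinearMap.range D)}) ∧
    -- (2): the image `ρ(L')`, smoothness of `ρ : L' → ρ(L')`, and the fibers over the points
    -- of `ρ(L')`, as schemes over `K`
    (QuadraticPair.rhoMap hV.nondegenerate BU '' QuadraticPair.surj K V U =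
        QuadraticPair.rankLocus BV (Module.finrank K U) ∧
      Smooth (QuadraticPair.rhoMor hε hV hU) ∧
      ∀ D : QuadraticPair.rankLocus BV (Module.finrank K U),
        ∃ e : (QuadraticPair.rhoMor hε hV hU).fiber (QuadraticPair.variety.pt K
            (QuadraticPair.rankLocus_locallyClosed BV (Module.finrank K U)) D) ≅
            QuadraticPair.variety K (QuadraticPair.isometries_locallyClosed BU),
          e.hom ≫ QuadraticPair.variety.toSpec K (QuadraticPair.isometries_locallyClosed BU) =
            (QuadraticPair.rhoMor hε hV hU).fiberι _ ≫
              QuadraticPair.variety.toSpec K QuadraticPair.surj_locallyClosed) := by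
  have h2 : (2 : K) ≠ 0 := by
    intro h
    have h1 : p ∣ 2 := (CharP.cast_eq_zero_iff K p 2).1 (by exact_mod_cast h)
    exact absurd (Nat.le_of_dvd two_pos h1) (by omega)
  have hrho := QuadraticPair.image_rhoMap h2 hε hV hU
  have bV := Module.finBasis K V
  have bU := Module.finBasis K U
  refine ⟨⟨QuadraticPair.variety.smooth_map _ _ _ _ _ fun X => ?_,
    QuadraticPair.image_piMap h2 hε hV hU⟩, hrho,
    QuadraticPair.variety.smooth_map _ _ _ _ _ fun X => ?_, fun D => ?_⟩
  · obtain ⟨a, ha⟩ := QuadraticPair.exists_detMulRight_ne_zero bV bU X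
    exact ⟨_, ha, QuadraticPair.smooth_away_of_lift (QuadraticPair.piComorphism hε hV hU) _
      (QuadraticPair.piComorphism_lift bV bU h2 hε hV hU hdim a)⟩
  · obtain ⟨a, ha⟩ := QuadraticPair.exists_detMulRight_ne_zero bV bU X
    exact ⟨_, ha, QuadraticPair.smooth_away_of_lift (QuadraticPair.rhoComorphism hε hV hU) _
      (QuadraticPair.rhoComorphism_lift bV bU h2 hε hV hU hdim hrho a)⟩
  -- By the description of the image, `D` has a preimage `X`, which serves as base point of the
  -- orbit.
  · obtain ⟨D, hD⟩ := D
    obtain ⟨X, hX, rfl⟩ := hrho.superset hD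
    exact QuadraticPair.exists_fiber_rhoMor_iso h2 hε hV hU ⟨X, hX⟩
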